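/- **Setting.** Let $p$ be a prime, let $a,b\in[1,p-1]$ be primitive roots modulo $p$ with $ab\equiv 1 \pmod p$, and let $n=\sum_{i=1}^{t}a_ip^{k_i}$ with $k_1>\dots>k_t\ge 0$ and $a_i\in[1,p-1]$ be the $p$-adic expansion of $n\in\mathbb N$. Permutations act on the right, $g^h=h^{-1}gh$, and for a subgroup $P$ of a symmetric group, $\chi\in\mathrm{Irr}(P)$ and $h$ in the normalizer of $P$ we put $\chi^h(g)=\chi(hgh^{-1})$. Let $\tau$ be the permutation of $[0,p]$ fixing $0$ and $p$ with $(x)\tau\equiv bx\pmod p$ for $x\in[1,p-1]$. *Groups.* Let $\gamma=(1,2,\dots,p)$ and $P_p=\langle\gamma\rangle$. For $k\ge1$, divide $[1,p^k]$ into $p$ consecutive blocks of length $p^{k-1}$, and write $(f_1,\dots,f_p;\delta)$ for the elements of $S_{p^{k-1}}\wr S_p\le S_{p^k}$. Put $g_k^{(k)}=(1,\dots,1;\gamma)$ and $g_j^{(k)}=(g_j^{(k-1)},1,\dots,1;1)$ for $1\le j<k$. Then $P_{p^k}=\langle g_1^{(k)},\dots,g_k^{(k)}\rangle=P_{p^{k-1}}\wr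 P_p$ is a Sylow $p$-subgroup of $S_{p^k}$ ($P_1=1$). Let $\sigma_k^{(k)}$ permute the $p$ blocks, preserving positions inside the blocks, as $\tau^{-1}$ permutes $[1,p]$ (that is, $i\mapsto ai \bmod p$), and for $1\le j<k$ let $\sigma_j^{(k)}$ act as $\sigma_j^{(k-1)}$ inside each block. Divide $[1,n]$ into consecutive blocks $(i,j)$, $i\in[1,t]$, $j\in[1,a_i]$, in lexicographic order, the block $(i,j)$ having length $p^{k_i}$; for $h\in S_{p^{k_i}}$ let $h^{\tau(i,j)}\in S_n$ act as $h$ on the block $(i,j)$ and trivially elsewhere. Let $P_n=\prod_{i,j}(P_{p^{k_i}})^{\tau(i,j)}$, a Sylow $p$-subgroup of $S_n$, let $N_n=N_{S_n}(P_n)$, and let $\sigma(i,j,\ell)=(\sigma_\ell^{(k_i)})^{\tau(i,j)}$ for $\ell\in[1,k_i]$. For $y\in[1,t]$ let $\xi_y$ exchange the blocks $(y,1)$ and $(y,2)$ (with $\xi_y=1$ if $a_y=1$) and let $\zeta_y$ permute the blocks $(y,1),\dots,(y,a_y)$ cyclically, both preserving positions inside blocks and fixing all other points. An element $\rho\in\langle\xi_y,\zeta_y\rangle$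 acts on $[1,a_y]$ so that $\big((P_{p^{k_y}})^{\tau(y,x)}\big)^{\rho}=(P_{p^{k_y}})^{\tau(y,(x)\rho)}$. *Tree functions.* A $p^k$-labeling function is a map $t$ from the set of sequences of length $\le k-1$ with entries in $[1,p]$ to $[0,p]$. Two of them are equivalent, $t_1\sim t_2$, if there are $\gamma_{q}\in P_p$, indexed by sequences $q$, with $t_1(s_1\cdots s_\ell)=t_2\big((s_1)\gamma_{\emptyset}\,(s_2)\gamma_{s_1}\cdots(s_\ell)\gamma_{s_1\cdots s_{\ell-1}}\big)$ for all sequences; a $p^k$-tree function is an equivalence class. For $k\ge 1$ write $t=(t_1\mid\dots\mid t_p;x)$ if $t(\emptyset)=x$ and $t_i(q)=t(iq)$, and use the same notation for classes. A tree function is admissible if $k=0$, or if $k\ge1$, its subfunctions $T_1,\dots,T_p$ are admissible, and $T_1,\dots,T_p$ are all equal when $x<p$ and not all equal when $x=p$; $\mathcal F_{p^k}$ is the set of admissible $p^k$-tree functions. Let $\phi_\varepsilon\in\mathrm{Irr}(P_p)$, $\varepsilon\in[0,p-1]$, be given by $\phi_\varepsilon(\gamma)=e^{2\pi i\varepsilon/p}$,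 and let $\mathcal X(\phi;\varepsilon)$ be the character of $P_{p^{k-1}}\wr P_p$ which is the canonical extension of $\phi^{\times p}$ (on the $p$-th tensor power) times the inflation of $\phi_\varepsilon$. The tree function of $\theta\in\mathrm{Irr}(P_{p^k})$ is defined recursively: for $k=0$ it is the unique $1$-tree function; for $k\ge 1$, $\mathcal T(\theta)=(\mathcal T(\phi)\mid\dots\mid\mathcal T(\phi);\varepsilon)$ if $\theta=\mathcal X(\phi;\varepsilon)$ with $\phi\in\mathrm{Irr}(P_{p^{k-1}})$, and $\mathcal T(\theta)=(\mathcal T(\theta_1)\mid\dots\mid\mathcal T(\theta_p);p)$ if $\theta=(\theta_1\times\dots\times\theta_p)\uparrow^{P_{p^k}}$ with $\theta_1,\dots,\theta_p\in\mathrm{Irr}(P_{p^{k-1}})$ not all equal. For $\theta\in\mathrm{Irr}(P_n)$ with $\theta=\prod_{i,j}\theta_{(i,j)}$, $\theta_{(i,j)}\in\mathrm{Irr}(P_{p^{k_i}})$, put $\mathcal T(\theta)=(\mathcal T(\theta_{(i,j)}))_{i,j}$. The normalizers act by $\mathcal T(\theta)^h=\mathcal T(\theta^h)$. **Theorem.**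 Let $\theta\in\mathrm{Irr}(P_n)$. Then $\theta=\prod_{i,j}\theta_{(i,j)}$ with uniquely determined $\theta_{(i,j)}\in\mathrm{Irr}(P_{p^{k_i}})$, and $\mathcal T=\mathcal T(\theta)=(\mathcal T(\theta_{(i,j)}))_{i,j}$ lies in $\mathcal F_n=\prod_{i}(\mathcal F_{p^{k_i}})^{a_i}$. Moreover: 1. Let $i\in[1,t]$, $j\in[1,a_i]$, $\ell\in[1,k_i]$. Then $\sigma(i,j,\ell)\in N_n$, $\sigma_\ell^{(k_i)}\in N_{S_{p^{k_i}}}(P_{p^{k_i}})$, the component $(i,j)$ of $\mathcal T^{\sigma(i,j,\ell)}$ is $\mathcal T(\theta_{(i,j)})^{\sigma_\ell^{(k_i)}}$, and every other component $(i',j')$ is $\mathcal T(\theta_{(i',j')})$. Here the action of $\sigma_\ell^{(k)}$ on $T=(T_1\mid\dots\mid T_p;x)=\mathcal T(\chi)$, $\chi\in\mathrm{Irr}(P_{p^k})$, is given by $$T^{\sigma_\ell^{(k)}}=\begin{cases}(T_1^{\sigma_\ell^{(k-1)}}\mid\dots\mid T_p^{\sigma_\ell^{(k-1)}};x)&\text{if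 }\ell<k,\\ (T_{(1)\tau}\mid\dots\mid T_{(p)\tau};(x)\tau)&\text{if }\ell=k.\end{cases}$$ 2. Let $y\in[1,t]$. Then $\langle\xi_y,\zeta_y\rangle\cong S_{a_y}$, and every $\rho\in\langle\xi_y,\zeta_y\rangle$ lies in $N_n$; the component $(y,j)$ of $\mathcal T^{\rho}$ is $\mathcal T(\theta_{(y,(j)\rho^{-1})})$ for $j\in[1,a_y]$, and every component $(z,j)$ with $z\ne y$ is $\mathcal T(\theta_{(z,j)})$. -/

import Mathlib

open Equiv

namespace SylowTree

/-! ### Irreducible complex characters -/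

section Characters

/-- `χ` is the character of an irreducible complex representation of `G`
(in coordinates: on some `ℂ^d`). -/
def IsIrrChar {G : Type*} [Group G] (χ : G → ℂ) : Prop :=
  ∃ (d : ℕ) (ρ : Representation ℂ G (Fin d → ℂ)), ρ.IsIrreducible ∧ χ = ρ.character

/-- The set `Irr(G)` of irreducible complex characters. -/
def Irr (G : Type*) [Group G] : Type _ := {χ : G → ℂ // IsIrrChar χ}

theorem IsIrrChar.comp_mulEquiv {G : Type*} [Group G] {χ : G → ℂ} (h : IsIrrChar χ)
    (c : G ≃* G) : IsIrrChar (fun g => χ (c g)) := by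
  obtain ⟨d, ρ, hρ, rfl⟩ := h
  refine ⟨d, ρ.comp c.toMonoidHom, ?_, rfl⟩
  let e : Subrepresentation ρ ≃o Subrepresentation (ρ.comp c.toMonoidHom) :=
    { toFun := fun W => ⟨W.toSubmodule, fun g _ hv => W.apply_mem_toSubmodule (c g) hv⟩
      invFun := fun W => ⟨W.toSubmodule, fun g v hv => by
        have := W.apply_mem_toSubmodule (c.symm g) hv
        simpa using this⟩
      left_inv := fun _ => rfl
      right_inv := fun _ => rfl
      map_rel_iff' := Iff.rfl }
  exact (OrderIso.isSimpleOrder_iff e).mp hρ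

/-- Conjugation `x ↦ h⁻¹ * x * h` on a subgroup `H` normalized by `h`. -/
def conjEquiv {G : Type*} [Group G] {H : Subgroup G} {h : G}
    (hh : h ∈ Subgroup.normalizer (H : Set G)) : H ≃* H where
  toFun x := ⟨h⁻¹ * x * h, by
    have := (Subgroup.mem_normalizer_iff.mp (inv_mem hh) x).mp x.2
    simpa using this⟩
  invFun x := ⟨h * x * h⁻¹, (Subgroup.mem_normalizer_iff.mp hh x).mp x.2⟩
  left_inv x := by ext; simp [mul_assoc]
  right_inv x := by ext; simp [mul_assoc]
  map_mul' x y := by ext; simp [mul_assoc]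

/-- The conjugate character `χ^h`. Permutations are composed from right to left here, so
`χ^h(x) = χ(h⁻¹ x h)` is the value of `χ` at the permutation obtained from `x` by relabelling the
points by `h⁻¹`; with permutations composed from left to right, the same permutation is written
`h x h⁻¹`. -/
def Irr.conj {G : Type*} [Group G] {H : Subgroup G} (χ : Irr H) {h : G}
    (hh : h ∈ Subgroup.normalizer (H : Set G)) : Irr H :=
  ⟨fun x => χ.1 (conjEquiv hh x), χ.2.comp_mulEquiv (conjEquiv hh)⟩

open Classical in
/-- The class function of the finite group `G` induced by `ψ : H → ℂ`. -/
noncomputable def induced {G : Type*} [Group G] (H : Subgroup G) (ψ : H → ℂ) (g : G) : ℂ :=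
  (Nat.card H : ℂ)⁻¹ * ∑ᶠ x : G, if hx : x⁻¹ * g * x ∈ H then ψ ⟨x⁻¹ * g * x, hx⟩ else 0

open scoped TensorProduct in
/-- The operator `v₁ ⊗ ⋯ ⊗ vₚ ↦ f₁ v_{s⁻¹(1)} ⊗ ⋯ ⊗ fₚ v_{s⁻¹(p)}` of the element `(f; s)` of a wreath
product on the tensor power of a representation `ρ` of the base factor. -/
noncomputable def wreathTensor {G V : Type*} [Group G] [AddCommGroup V] [Module ℂ V] {p : ℕ}
    (ρ : Representation ℂ G V) (f : Fin p → G) (s : Perm (Fin p)) :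
    (⨂[ℂ] _ : Fin p, V) →ₗ[ℂ] (⨂[ℂ] _ : Fin p, V) :=
  (PiTensorProduct.map fun i => ρ (f i)) ∘ₗ
    (PiTensorProduct.reindex ℂ (fun _ : Fin p => V) s).toLinearMap

end Characters

/-! ### The Sylow subgroup of `S_{p^k}` and the elements of its normalizer

Points, blocks and sequence entries are numbered from `0`: the element `x` of `Fin m` stands for the
element `x + 1` of `[1, m]`. -/

section PrimePower

variable (p : ℕ)

/-- The point with offset `r` in the `i`-th block of length `p ^ k` is `r + p ^ k * i`. -/
def blockEquiv (k : ℕ) : Fin p × Fin (p ^ k) ≃ Fin (p ^ (k + 1)) :=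
  finProdFinEquiv.trans (finCongr (pow_succ' p k).symm)

variable {p}

/-- The permutation `(f; s)` of the points: block `i` goes to block `s i`, and then `f (s i)` is
applied inside this block. -/
def wr {k : ℕ} (f : Fin p → Perm (Fin (p ^ k))) (s : Perm (Fin p)) : Perm (Fin (p ^ (k + 1))) :=
  (blockEquiv p k).permCongr (Equiv.prodShear s fun i => f (s i))

theorem wr_mul {k : ℕ} (f g : Fin p → Perm (Fin (p ^ k))) (s t : Perm (Fin p)) :
    wr f s * wr g t = wr (fun i => f i * g (s⁻¹ i)) (s * t) := by
  ext x
  obtain ⟨⟨i, r⟩, rfl⟩ := (blockEquiv p k).surjective x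
  simp [wr, Equiv.permCongr_apply, Equiv.prodShear]

theorem wr_one {k : ℕ} : wr (1 : Fin p → Perm (Fin (p ^ k))) 1 = 1 := by
  ext x
  obtain ⟨⟨i, r⟩, rfl⟩ := (blockEquiv p k).surjective x
  simp [wr, Equiv.permCongr_apply, Equiv.prodShear]

variable (p) [Fact p.Prime]

/-- The group `P_p` generated by the cycle `γ = (1, 2, …, p)`. -/
def cyc : Subgroup (Perm (Fin p)) := Subgroup.zpowers (finRotate p)

/-- The permutations `g_j^{(k)}`, for `1 ≤ j ≤ k`: `g_k^{(k)} = (1, …, 1; γ)` and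
`g_j^{(k)} = (g_j^{(k-1)}, 1, …, 1; 1)` for `j < k`. -/
def gen : (k j : ℕ) → Perm (Fin (p ^ k))
  | 0, _ => 1
  | k + 1, j => if j = k + 1 then wr 1 (finRotate p) else wr (Pi.mulSingle 0 (gen k j)) 1

/-- The Sylow `p`-subgroup `P_{p^k}` of `S_{p^k}`. -/
def P (k : ℕ) : Subgroup (Perm (Fin (p ^ k))) :=
  Subgroup.closure {g | ∃ j, 1 ≤ j ∧ j ≤ k ∧ g = gen p k j}

variable {p}

/-- Every element of `P_{p^(k+1)}` has the form `(f; s)` of an element of `P_{p^k} ≀ P_p`. -/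
theorem exists_wr {k : ℕ} {x : Perm (Fin (p ^ (k + 1)))} (hx : x ∈ P p (k + 1)) :
    ∃ (f : Fin p → P p k) (s : cyc p), x = wr (fun i => (f i : Perm (Fin (p ^ k)))) s := by
  induction hx using Subgroup.closure_induction with
  | mem x hx =>
    obtain ⟨j, hj1, hj2, rfl⟩ := hx
    by_cases hj : j = k + 1
    · exact ⟨1, ⟨finRotate p, Subgroup.mem_zpowers _⟩, by simp [gen, hj, Pi.one_def]⟩
    · refine ⟨Pi.mulSingle 0 ⟨gen p k j, Subgroup.subset_closure ⟨j, hj1, by omega, rfl⟩⟩, 1, ?_⟩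
      have : (fun i => (((Pi.mulSingle 0
          ⟨gen p k j, Subgroup.subset_closure ⟨j, hj1, by omega, rfl⟩⟩ : Fin p → P p k) i : P p k)
            : Perm (Fin (p ^ k)))) = Pi.mulSingle 0 (gen p k j) := by
        funext i
        by_cases hi : i = 0
        · subst hi; simp
        · simp [Pi.mulSingle_eq_of_ne hi]
      rw [this]
      simp [gen, hj]
  | one => exact ⟨1, 1, by simpa using! wr_one.symm⟩
  | mul x y _ _ ihx ihy =>
    obtain ⟨f, s, rfl⟩ := ihx
    obtain ⟨g, t, rfl⟩ := ihy
    exact ⟨fun i => f i * g ((s : Perm (Fin p))⁻¹ i), s * t, by rw [wr_mul]; simp⟩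
  | inv x _ ih =>
    obtain ⟨f, s, rfl⟩ := ih
    refine ⟨fun i => (f ((s : Perm (Fin p)) i))⁻¹, s⁻¹, ?_⟩
    rw [inv_eq_iff_mul_eq_one, wr_mul]
    simpa using! wr_one

/-- The components `f_1, …, f_p` of an element `(f; s)` of `P_{p^(k+1)}`. -/
noncomputable def base {k : ℕ} (x : P p (k + 1)) : Fin p → P p k := (exists_wr x.2).choose

/-- The component `s` of an element `(f; s)` of `P_{p^(k+1)}`. -/
noncomputable def top {k : ℕ} (x : P p (k + 1)) : cyc p := (exists_wr x.2).choose_spec.choose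

/-- The embedding `f ↦ (f; 1)` of the base group `(P_{p^k})^p`. -/
def baseHom (k : ℕ) : (Fin p → P p k) →* Perm (Fin (p ^ (k + 1))) where
  toFun f := wr (fun i => (f i : Perm (Fin (p ^ k)))) 1
  map_one' := wr_one
  map_mul' f g := by rw [wr_mul]; simp

/-- The base group, as a subgroup of `P_{p^(k+1)}`. -/
def baseGroup (k : ℕ) : Subgroup (P p (k + 1)) := (baseHom k).range.subgroupOf (P p (k + 1))

/-- The linear character `φ_ε` of `P_p`, with `φ_ε(γ ^ m) = ω ^ (ε m)` for `ω = exp(2πi/p)`;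
note that `γ ^ m` sends `0` to the residue of `m`. -/
noncomputable def phi (ε : Fin p) (s : cyc p) : ℂ :=
  Complex.exp (2 * Real.pi * Complex.I / p) ^ ((ε : ℕ) * (((s : Perm (Fin p)) 0 : Fin p) : ℕ))

/-- The character `𝒳(φ; ε)` of `P_{p^(k+1)} = P_{p^k} ≀ P_p`: the character of the tensor power of a
module affording `φ`, multiplied by the inflation of `φ_ε`. -/
noncomputable def calX {k : ℕ} (φ : Irr (P p k)) (ε : Fin p) (x : P p (k + 1)) : ℂ :=
  LinearMap.trace ℂ _ (wreathTensor φ.2.choose_spec.choose (base x) (top x)) * phi ε (top x)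

/-- The character `(θ_1 × ⋯ × θ_p)↑` of `P_{p^(k+1)}`, induced from the base group. -/
noncomputable def indProd {k : ℕ} (θ : Fin p → Irr (P p k)) : P p (k + 1) → ℂ :=
  induced (baseGroup k) fun x => ∏ i, (θ i).1 (base x.1 i)

variable (p) in
/-- The element `i` of `Fin p` stands for `i + 1 ∈ [1, p]`; this is its residue class mod `p`. -/
def residue : Fin p ≃ ZMod p := (ZMod.finEquiv p).toEquiv.trans (Equiv.addRight 1)

/-- The permutation `i ↦ u i mod p` of `[1, p]`. For a primitive root `u ≡ a` it is the
cycle `σ_1^{(1)} = (a_1, …, a_{p-1})` with `a_i ≡ a ^ i`. -/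
def mulPerm (u : (ZMod p)ˣ) : Perm (Fin p) := (residue p).symm.permCongr (Units.mulLeft u)

/-- The permutations `σ_j^{(k)}`, for `1 ≤ j ≤ k`: `σ_k^{(k)}` permutes the `p` blocks of length
`p ^ (k-1)` as `σ_1^{(1)}` permutes `[1, p]`, and `σ_j^{(k)}`, for `j < k`, acts as `σ_j^{(k-1)}` in
each of these blocks. -/
def sigma (u : (ZMod p)ˣ) : (k j : ℕ) → Perm (Fin (p ^ k))
  | 0, _ => 1
  | k + 1, j => if j = k + 1 then wr 1 (mulPerm u) else wr (fun _ => sigma u k j) 1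

end PrimePower

/-! ### Tree functions -/

section Trees

variable (p : ℕ)

/-- The `p^k`-skeleton: sequences of length at most `k - 1` with entries in `[1, p]`. -/
def Skeleton (k : ℕ) : Type := {s : List (Fin p) // s.length < k}

/-- The `p^k`-labeling functions, with labels in `[0, p]`. -/
def Labeling (k : ℕ) : Type := Skeleton p k → Fin (p + 1)

variable {p}

namespace Labeling

/-- The label `t(∅)` of the empty sequence. -/
def root {k : ℕ} (t : Labeling p (k + 1)) : Fin (p + 1) := t ⟨[], Nat.succ_pos k⟩

/-- The labeling subfunction of `t` rooted at the sequence `i` of length one. -/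
def sub {k : ℕ} (t : Labeling p (k + 1)) (i : Fin p) : Labeling p k :=
  fun q => t ⟨i :: q.1, Nat.succ_lt_succ q.2⟩

/-- The labeling function `(f_1 ∣ ⋯ ∣ f_p; ε)`. -/
def node {k : ℕ} (f : Fin p → Labeling p k) (ε : Fin (p + 1)) : Labeling p (k + 1)
  | ⟨[], _⟩ => ε
  | ⟨i :: q, h⟩ => f i ⟨q, Nat.lt_of_succ_lt_succ h⟩

end Labeling

/-- The sequence `(s_1)γ_∅ (s_2)γ_{s_1} (s_3)γ_{s_1 s_2} ⋯` obtained from `s = s_1 s_2 s_3 ⋯`. -/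
def twist : (List (Fin p) → Perm (Fin p)) → List (Fin p) → List (Fin p)
  | _, [] => []
  | γ, x :: s => γ [] x :: twist (fun q => γ (x :: q)) s

@[simp] theorem length_twist (γ : List (Fin p) → Perm (Fin p)) (s : List (Fin p)) :
    (twist γ s).length = s.length := by
  induction s generalizing γ with
  | nil => rfl
  | cons x s ih => simp [twist, ih]

/-- The sequence `twist γ s`, as an element of the skeleton. -/
def Skeleton.twist {k : ℕ} (γ : List (Fin p) → Perm (Fin p)) (s : Skeleton p k) : Skeleton p k :=
  ⟨SylowTree.twist γ s.1, by rw [length_twist]; exact s.2⟩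

theorem twist_one (s : List (Fin p)) : twist (fun _ => 1) s = s := by
  induction s with
  | nil => rfl
  | cons x s ih => simp [twist, ih]

theorem twist_twist (γ δ : List (Fin p) → Perm (Fin p)) (s : List (Fin p)) :
    twist δ (twist γ s) = twist (fun q => δ (twist γ q) * γ q) s := by
  induction s generalizing γ δ with
  | nil => rfl
  | cons x s ih => simp [twist, ih]

/-- The family inverse to `γ` with respect to `twist`. -/
def invTwist : (List (Fin p) → Perm (Fin p)) → List (Fin p) → Perm (Fin p)
  | γ, [] => (γ [])⁻¹
  | γ, y :: q => invTwist (fun r => γ ((γ [])⁻¹ y :: r)) q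

theorem twist_invTwist (γ : List (Fin p) → Perm (Fin p)) (s : List (Fin p)) :
    twist γ (twist (invTwist γ) s) = s := by
  induction s generalizing γ with
  | nil => rfl
  | cons x s ih => simpa [twist, invTwist] using ih _

theorem invTwist_mem {H : Subgroup (Perm (Fin p))} (γ : List (Fin p) → Perm (Fin p))
    (h : ∀ q, γ q ∈ H) (q : List (Fin p)) : invTwist γ q ∈ H := by
  induction q generalizing γ with
  | nil => exact inv_mem (h [])
  | cons y q ih => exact ih _ fun r => h _

variable (p) [Fact p.Prime]

/-- The equivalence relation on labeling functions: `t₁ ∼ t₂` if there are `γ_q ∈ P_p` with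
`t₁(s) = t₂((s_1)γ_∅ (s_2)γ_{s_1} ⋯)` for all `s`. Only the `γ_q` with `q` of length
less than `k - 1` matter, and the case `s = ∅` says `t₁(∅) = t₂(∅)`. -/
instance treeSetoid (k : ℕ) : Setoid (Labeling p k) where
  r t₁ t₂ := ∃ γ : List (Fin p) → Perm (Fin p), (∀ q, γ q ∈ cyc p) ∧
    ∀ s : Skeleton p k, t₁ s = t₂ (s.twist γ)
  iseqv :=
    { refl := fun t => ⟨fun _ => 1, fun _ => one_mem _, fun s =>
        congrArg t (Subtype.ext (twist_one s.1).symm)⟩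
      symm := by
        rintro t₁ t₂ ⟨γ, hγ, h⟩
        refine ⟨invTwist γ, invTwist_mem γ hγ, fun s => ?_⟩
        rw [h]
        exact congrArg t₂ (Subtype.ext (twist_invTwist γ s.1).symm)
      trans := by
        rintro t₁ t₂ t₃ ⟨γ, hγ, h⟩ ⟨δ, hδ, h'⟩
        refine ⟨fun q => δ (twist γ q) * γ q, fun q => mul_mem (hδ _) (hγ _), fun s => ?_⟩
        rw [h, h']
        exact congrArg t₃ (Subtype.ext (twist_twist γ δ s.1)) }

/-- The `p^k`-tree functions: equivalence classes of `p^k`-labeling functions. -/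
def TreeFun (k : ℕ) : Type := Quotient (treeSetoid p k)

variable {p}

/-- The tree function of a labeling function. -/
def Labeling.toTree {k : ℕ} (t : Labeling p k) : TreeFun p k := Quotient.mk (treeSetoid p k) t

namespace TreeFun

/-- The tree function `(F_1 ∣ ⋯ ∣ F_p; ε)`, formed with representatives of `F_1, …, F_p`. -/
noncomputable def node {k : ℕ} (F : Fin p → TreeFun p k) (ε : Fin (p + 1)) : TreeFun p (k + 1) :=
  (Labeling.node (fun i => Quotient.out (F i)) ε).toTree

end TreeFun

/-- Admissible labeling functions. All subfunctions rooted at sequences of length one have to be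
admissible, and their classes are all equal if `t(∅) ∈ [0, p-1]`, and not all equal if `t(∅) = p`.
The skeleton is empty for `k = 0`, so for `k = 1` the condition is `t(∅) ∈ [0, p-1]`. -/
def Labeling.Admissible : {k : ℕ} → Labeling p k → Prop
  | 0, _ => True
  | _ + 1, t => (∀ i, Labeling.Admissible (t.sub i)) ∧
      (t.root ≠ Fin.last p → ∀ i j, (t.sub i).toTree = (t.sub j).toTree) ∧
      (t.root = Fin.last p → ¬ ∀ i j, (t.sub i).toTree = (t.sub j).toTree)

variable (p) in
/-- The set `ℱ_{p^k}` of admissible tree functions. -/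
def admissibleTrees (k : ℕ) : Set (TreeFun p k) :=
  {T | ∀ t : Labeling p k, t.toTree = T → t.Admissible}

open Classical in
/-- The tree function `𝒯(θ)` of an irreducible character of `P_{p^k}`. For `k = 0` there is only one
tree function. An irreducible character of `P_{p^(k+1)}` is either `𝒳(φ; ε)`, and then its tree
function is `(𝒯(φ) ∣ ⋯ ∣ 𝒯(φ); ε)`, or `(θ_1 × ⋯ × θ_p)↑` with `θ_1, …, θ_p` not all equal, and then
its tree function is `(𝒯(θ_1) ∣ ⋯ ∣ 𝒯(θ_p); p)`. The last alternative never occurs. -/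
noncomputable def tree : {k : ℕ} → Irr (P p k) → TreeFun p k
  | 0, _ => Labeling.toTree fun _ => 0
  | k + 1, θ =>
    if h : ∃ (φ : Irr (P p k)) (ε : Fin p), θ.1 = calX φ ε then
      TreeFun.node (fun _ => tree h.choose) h.choose_spec.choose.castSucc
    else if h : ∃ θs : Fin p → Irr (P p k), (¬ ∀ i j, θs i = θs j) ∧ θ.1 = indProd θs then
      TreeFun.node (fun i => tree (h.choose i)) (Fin.last p)
    else Labeling.toTree fun _ => 0

/-- The permutation `τ = (σ_1^{(1)})⁻¹` of the labels: `ε ↦ u⁻¹ ε mod p` on `[0, p-1]`, and `p` is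
fixed. -/
def tauLabel (u : (ZMod p)ˣ) (x : Fin (p + 1)) : Fin (p + 1) :=
  if x = Fin.last p then Fin.last p else
    ⟨(((u⁻¹ : (ZMod p)ˣ) : ZMod p) * ((x : ℕ) : ZMod p)).val, (ZMod.val_lt _).trans (Nat.lt_succ_self p)⟩

/-- The explicit action of `σ_j^{(k)}` on labeling functions: a labeling function
`(t_1 ∣ ⋯ ∣ t_p; x)` goes to `(t_{(1)τ} ∣ ⋯ ∣ t_{(p)τ}; (x)τ)` if `j = k`, and to the labeling function
`(t_1^{σ_j^{(k-1)}} ∣ ⋯ ∣ t_p^{σ_j^{(k-1)}}; x)` if `j < k`. -/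
def Labeling.sigmaAct (u : (ZMod p)ˣ) : {k : ℕ} → (j : ℕ) → Labeling p k → Labeling p k
  | 0, _, t => t
  | k + 1, j, t =>
    if j = k + 1 then Labeling.node (fun i => t.sub ((mulPerm u)⁻¹ i)) (tauLabel u t.root)
    else Labeling.node (fun i => Labeling.sigmaAct u j (t.sub i)) t.root

end Trees

/-! ### The Sylow subgroup of `S_n` -/

/-- The `p`-adic expansion `n = ∑ a_i p^{k_i}` with `k_1 > ⋯ > k_t ≥ 0` and `a_i ∈ [1, p-1]`. -/
structure PadicExpansion (p n : ℕ) where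
  t : ℕ
  a : Fin t → ℕ
  k : Fin t → ℕ
  k_anti : StrictAnti k
  a_pos : ∀ i, 1 ≤ a i
  a_le : ∀ i, a i ≤ p - 1
  sum_eq : ∑ i, a i * p ^ k i = n

namespace PadicExpansion

variable {p n : ℕ} (E : PadicExpansion p n)

/-- The point `(i, j, x)` is `x + p^{k_i} * j + ∑_{z < i} a_z p^{k_z}`: the point with offset `x` in
the `j`-th block of length `p^{k_i}`. -/
def point : (Σ i, Fin (E.a i) × Fin (p ^ E.k i)) ≃ Fin n :=
  (Equiv.sigmaCongrRight fun _ => finProdFinEquiv).trans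
    (finSigmaFinEquiv.trans (finCongr E.sum_eq))

/-- The permutation acting as `h i j` on the block `(i, j)`. -/
def blockHom : (∀ i, Fin (E.a i) → Perm (Fin (p ^ E.k i))) →* Perm (Fin n) where
  toFun h := E.point.permCongr
    (Equiv.Perm.sigmaCongrRight fun i => Equiv.prodShear (Equiv.refl _) (h i))
  map_one' := by
    ext x
    obtain ⟨⟨i, j, r⟩, rfl⟩ := E.point.surjective x
    simp [Equiv.permCongr_apply, Equiv.prodShear]
  map_mul' f g := by
    ext x
    obtain ⟨⟨i, j, r⟩, rfl⟩ := E.point.surjective x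
    simp [Equiv.permCongr_apply, Equiv.prodShear]

/-- The map `h ↦ h^{τ(i,j)}`, which makes a permutation of `[1, p^{k_i}]` act on the block `(i, j)`. -/
def shiftHom (i : Fin E.t) (j : Fin (E.a i)) : Perm (Fin (p ^ E.k i)) →* Perm (Fin n) :=
  E.blockHom.comp ((MonoidHom.mulSingle _ i).comp (MonoidHom.mulSingle (fun _ : Fin (E.a i) => Perm (Fin (p ^ E.k i))) j))

/-- The permutation of `[1, n]` that permutes the `a_i` blocks of length `p^{k_i}` by `π`, preserving
the offset of each point in its block. -/
def permBlocks (i : Fin E.t) (π : Perm (Fin (E.a i))) : Perm (Fin n) :=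
  E.point.permCongr (Equiv.Perm.sigmaCongrRight (Pi.mulSingle i (Equiv.prodCongr π (Equiv.refl _))))

/-- `ξ_i` exchanges the first two blocks of length `p^{k_i}` (and is `1` if `a_i = 1`). -/
def xi (i : Fin E.t) : Perm (Fin n) :=
  if h : 2 ≤ E.a i then
    E.permBlocks i (Equiv.swap ⟨0, Nat.lt_of_lt_of_le Nat.zero_lt_two h⟩ ⟨1, h⟩)
  else 1

/-- `ζ_i` permutes the blocks of length `p^{k_i}` cyclically. -/
def zeta (i : Fin E.t) : Perm (Fin n) := E.permBlocks i (finRotate (E.a i))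

/-- The group `⟨ξ_i, ζ_i⟩`. -/
def rhoGroup (i : Fin E.t) : Subgroup (Perm (Fin n)) := Subgroup.closure {E.xi i, E.zeta i}

variable [Fact p.Prime]

/-- The embedding of the direct product of the groups `P_{p^{k_i}}` in `S_n`. -/
def prodHom : (∀ i, Fin (E.a i) → P p (E.k i)) →* Perm (Fin n) where
  toFun x := E.blockHom fun i j => (x i j : Perm (Fin (p ^ E.k i)))
  map_one' := E.blockHom.map_one
  map_mul' _ _ := E.blockHom.map_mul _ _

/-- The Sylow `p`-subgroup `P_n = ∏ (P_{p^{k_i}})^{τ(i,j)}` of `S_n`. -/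
def sylow : Subgroup (Perm (Fin n)) := E.prodHom.range

/-- The direct factor `(P_{p^{k_i}})^{τ(i,j)}` of `P_n`. -/
def factor (i : Fin E.t) (j : Fin (E.a i)) : Subgroup (Perm (Fin n)) :=
  (P p (E.k i)).map (E.shiftHom i j)

/-- The normalizer `N_n` of `P_n` in `S_n`. -/
def N : Subgroup (Perm (Fin n)) := Subgroup.normalizer (E.sylow : Set (Perm (Fin n)))

/-- `σ(i,j,ℓ) = (σ_ℓ^{(k_i)})^{τ(i,j)}`. -/
def sigma (u : (ZMod p)ˣ) (i : Fin E.t) (j : Fin (E.a i)) (ℓ : ℕ) : Perm (Fin n) :=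
  E.shiftHom i j (SylowTree.sigma u (E.k i) ℓ)

/-- `θ` is the direct product of the characters `θs i j` of the direct factors of `P_n`. -/
def IsProd (θ : Irr E.sylow) (θs : ∀ i, Fin (E.a i) → Irr (P p (E.k i))) : Prop :=
  ∀ x : ∀ i, Fin (E.a i) → P p (E.k i),
    θ.1 (E.prodHom.rangeRestrict x) = ∏ i, ∏ j, (θs i j).1 (x i j)

open Classical in
/-- The tree function `𝒯(θ)`, the tuple of the tree functions of the factors of `θ`. Every irreducible
character of `P_n` is such a product, so the second alternative never occurs. -/
noncomputable def tree (θ : Irr E.sylow) : ∀ i, Fin (E.a i) → TreeFun p (E.k i) :=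
  if h : ∃ θs, E.IsProd θ θs then fun i j => SylowTree.tree (h.choose i j)
  else fun _ _ => Labeling.toTree fun _ => 0

/-- The permutation `π` of `[1, a_i]` is induced by `ρ`: for all `x`,
the conjugate of the direct factor `(i, x)` by `ρ` is the direct factor `(i, π x)`. -/
def Induces (i : Fin E.t) (ρ : Perm (Fin n)) (π : Perm (Fin (E.a i))) : Prop :=
  ∀ x, (E.factor i x).map (MulAut.conj ρ).toMonoidHom = E.factor i (π x)

end PadicExpansion

end SylowTree

/-!
Clifford theory for `P_{p^(k+1)} = P_{p^k} ≀ P_p`. Let `θ` be an irreducible character and let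
`φ_1 × ⋯ × φ_p` be a constituent of its restriction to the base group. By Frobenius reciprocity `θ`
is a constituent of `(φ_1 × ⋯ × φ_p)↑`. If the `φ_i` all equal `φ`, this induced character is
`∑_ε 𝒳(φ; ε)`, so `θ` is one of the `𝒳(φ; ε)`. Otherwise the stabilizer of `(φ_1, …, φ_p)` in `P_p`
is trivial because `p` is prime, so the induced character has norm one and equals `θ`.

An element `(h, …, h; m)` normalizing `P_{p^(k+1)}` conjugates `(f; s)` to `(f'; m⁻¹ s m)` with
`f'_i = h⁻¹ f_{m(i)} h`. Hence it conjugates all subfunctions of a tree function by `h`, permutes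
them by `m`, and changes the label `ε` as `m` changes `φ_ε`; for multiplication by `u` on `[1, p]`
this is multiplication of `ε` by `u⁻¹`. The action of `σ_j^{(k)}` follows by induction on `k`, and
the characters of `P_n` are products of characters of its direct factors.
-/

namespace SylowTree

/-! ### Characters of finite groups -/

section Representations

open Module

variable {k G V W : Type*} [Field k] [Group G] [AddCommGroup V] [Module k V] [AddCommGroup W]
  [Module k W]

theorem isIrreducible_comp_mulEquiv {H : Type*} [Group H] {ρ : Representation k G V} (c : H ≃* G)
    (hρ : ρ.IsIrreducible) : Representation.IsIrreducible (ρ.comp c.toMonoidHom) := by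
  let o : Subrepresentation ρ ≃o Subrepresentation (ρ.comp c.toMonoidHom) :=
    { toFun := fun U => ⟨U.toSubmodule, fun h _ hv => U.apply_mem_toSubmodule (c h) hv⟩
      invFun := fun U => ⟨U.toSubmodule, fun g v hv => by
        obtain ⟨h, rfl⟩ := c.surjective g
        exact U.apply_mem_toSubmodule h hv⟩
      left_inv := fun _ => rfl
      right_inv := fun _ => rfl
      map_rel_iff' := Iff.rfl }
  exact (OrderIso.isSimpleOrder_iff o).mp hρ

theorem exists_equiv_fin [FiniteDimensional k V] (ρ : Representation k G V) :
    ∃ (d : ℕ) (σ : Representation k G (Fin d → k)), Nonempty (ρ.Equiv σ) := by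
  let e := (finBasis k V).equivFun
  exact ⟨finrank k V, (e.conjRingEquiv : End k V →* End k (Fin (finrank k V) → k)).comp ρ,
    ⟨.mk e fun g => LinearMap.ext fun v => by simp [LinearEquiv.conjRingEquiv]⟩⟩

theorem character_eq_add_of_isCompl [FiniteDimensional k V] {ρ : Representation k G V}
    {U W : Subrepresentation ρ} (h : IsCompl U W) :
    ρ.character = U.toRepresentation.character + W.toRepresentation.character := by
  have hc : IsCompl U.toSubmodule W.toSubmodule :=
    ⟨disjoint_iff.mpr (congrArg Subrepresentation.toSubmodule (disjoint_iff.mp h.1)),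
      codisjoint_iff.mpr (congrArg Subrepresentation.toSubmodule (codisjoint_iff.mp h.2))⟩
  let e := Submodule.prodEquivOfIsCompl _ _ hc
  funext g
  have hg : ρ g = e.conj ((U.toRepresentation g).prodMap (W.toRepresentation g)) := by
    ext v
    obtain ⟨⟨a, b⟩, rfl⟩ := e.surjective v
    rw [LinearEquiv.conj_apply_apply, LinearEquiv.symm_apply_apply]
    simp [e, Subrepresentation.toRepresentation]
  rw [Representation.character, hg, LinearMap.trace_conj', LinearMap.trace_prodMap']
  rfl

theorem nonempty_equiv_of_character_eq [Finite G] [IsAlgClosed k] [NeZero (Nat.card G : k)]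
    [FiniteDimensional k V] [FiniteDimensional k W] {ρ : Representation k G V}
    {σ : Representation k G W} [ρ.IsIrreducible] [σ.IsIrreducible]
    (h : ρ.character = σ.character) : Nonempty (ρ.Equiv σ) := by
  classical
  have := Fintype.ofFinite G
  let _ := invertibleOfNonzero (NeZero.ne (Nat.card G : k))
  have hσρ := Representation.char_orthonormal σ ρ
  have hσσ := Representation.char_orthonormal σ σ
  rw [← h, if_pos ⟨Representation.Equiv.refl σ⟩] at hσσ
  by_contra hne
  rw [← h, if_neg hne, hσσ] at hσρ
  exact one_ne_zero hσρ

end Representations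

section Characters

open Module

variable {G : Type*} [Group G]

/-- `χ` is the character of a finite-dimensional complex representation of `G`, which need not be
irreducible. -/
def IsChar (χ : G → ℂ) : Prop :=
  ∃ (d : ℕ) (ρ : Representation ℂ G (Fin d → ℂ)), χ = ρ.character

theorem isChar_character {V : Type*} [AddCommGroup V] [Module ℂ V] [FiniteDimensional ℂ V]
    (ρ : Representation ℂ G V) : IsChar ρ.character := by
  obtain ⟨d, σ, ⟨e⟩⟩ := exists_equiv_fin ρ
  exact ⟨d, σ, Representation.char_iso e⟩

theorem IsIrrChar.isChar {χ : G → ℂ} (h : IsIrrChar χ) : IsChar χ :=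
  let ⟨d, ρ, _, hχ⟩ := h
  ⟨d, ρ, hχ⟩

theorem IsChar.comp_hom {H : Type*} [Group H] {χ : G → ℂ} (h : IsChar χ) (f : H →* G) :
    IsChar (χ ∘ f) := by
  obtain ⟨d, ρ, rfl⟩ := h
  exact ⟨d, ρ.comp f, rfl⟩

theorem IsIrrChar.comp_equiv {H : Type*} [Group H] {χ : G → ℂ} (h : IsIrrChar χ) (c : H ≃* G) :
    IsIrrChar (χ ∘ c) := by
  obtain ⟨d, ρ, hρ, rfl⟩ := h
  exact ⟨d, ρ.comp c.toMonoidHom, isIrreducible_comp_mulEquiv c hρ, rfl⟩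

theorem isChar_one : IsChar (1 : G → ℂ) :=
  ⟨1, Representation.trivial ℂ G (Fin 1 → ℂ), by funext g; simp [Representation.character]⟩

theorem IsChar.mul {χ ψ : G → ℂ} (h : IsChar χ) (h' : IsChar ψ) : IsChar (χ * ψ) := by
  obtain ⟨d, ρ, rfl⟩ := h
  obtain ⟨e, σ, rfl⟩ := h'
  rw [← Representation.char_tensor]
  exact isChar_character _

theorem IsChar.prod {ι : Type*} (s : Finset ι) {χ : ι → G → ℂ} (h : ∀ i, IsChar (χ i)) :
    IsChar (∏ i ∈ s, χ i) :=
  Finset.prod_induction χ IsChar (fun _ _ => IsChar.mul) isChar_one fun i _ => h i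

theorem IsChar.apply_conj {χ : G → ℂ} (h : IsChar χ) (g x : G) : χ (x⁻¹ * g * x) = χ g := by
  obtain ⟨d, ρ, rfl⟩ := h
  simpa using ρ.char_conj g x⁻¹

theorem IsChar.apply_one_ne_zero {χ : G → ℂ} (h : IsChar χ) (h0 : χ ≠ 0) : χ 1 ≠ 0 := by
  obtain ⟨d, ρ, rfl⟩ := h
  refine fun h1 => h0 ?_
  obtain rfl : d = 0 := by simpa using h1
  funext g
  simp [Representation.character, Subsingleton.elim (ρ g) 0]

theorem IsIrrChar.apply_one_ne_zero {χ : G → ℂ} (h : IsIrrChar χ) : χ 1 ≠ 0 := by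
  obtain ⟨d, ρ, hρ, rfl⟩ := h
  intro h1
  obtain rfl : d = 0 := by simpa using h1
  obtain ⟨⟨U, W, hUW⟩⟩ := hρ.toNontrivial
  exact hUW (Subrepresentation.toSubmodule_injective (Subsingleton.elim _ _))

theorem character_toRepresentation_ne_zero {V : Type*} [AddCommGroup V] [Module ℂ V]
    [FiniteDimensional ℂ V] {ρ : Representation ℂ G V} {U : Subrepresentation ρ} (hU : U ≠ ⊥) :
    U.toRepresentation.character ≠ 0 := fun h =>
  hU <| Subrepresentation.toSubmodule_injective <| Submodule.finrank_eq_zero.mp <| by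
    exact Nat.cast_eq_zero (R := ℂ).mp ((Representation.char_one _).symm.trans (congrFun h 1))

theorem IsChar.exists_add_of_not_isIrrChar [Finite G] {χ : G → ℂ} (h : IsChar χ) (h0 : χ ≠ 0)
    (hirr : ¬ IsIrrChar χ) :
    ∃ χ₁ χ₂ : G → ℂ, IsChar χ₁ ∧ IsChar χ₂ ∧ χ₁ ≠ 0 ∧ χ₂ ≠ 0 ∧ χ = χ₁ + χ₂ := by
  have h1 := h.apply_one_ne_zero h0
  obtain ⟨d, ρ, rfl⟩ := h
  have hbt : (⊥ : Subrepresentation ρ) ≠ ⊤ := fun hbt => by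
    have hbt' : (⊥ : Submodule ℂ (Fin d → ℂ)) = ⊤ := congrArg Subrepresentation.toSubmodule hbt
    rw [Representation.char_one, ← finrank_top, ← hbt', finrank_bot] at h1
    exact h1 Nat.cast_zero
  obtain ⟨U, hU⟩ : ∃ U : Subrepresentation ρ, U ≠ ⊥ ∧ U ≠ ⊤ := by
    by_contra! hcon
    exact hirr ⟨d, ρ, { toNontrivial := ⟨_, _, hbt⟩
                        eq_bot_or_eq_top := fun U => or_iff_not_imp_left.mpr (hcon U) }, rfl⟩
  have : NeZero (Nat.card G : ℂ) := ⟨Nat.cast_ne_zero.mpr Nat.card_pos.ne'⟩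
  obtain ⟨W, hW⟩ := (inferInstance : ρ.IsSemisimpleRepresentation).exists_isCompl U
  have hW0 : W ≠ ⊥ := fun h => hU.2 (by simpa [h] using hW.sup_eq_top)
  exact ⟨_, _, isChar_character _, isChar_character _, character_toRepresentation_ne_zero hU.1,
    character_toRepresentation_ne_zero hW0, character_eq_add_of_isCompl hW⟩

theorem IsChar.induction [Finite G] {C : (G → ℂ) → Prop} {χ : G → ℂ} (h : IsChar χ)
    (zero : C 0) (irr : ∀ χ, IsIrrChar χ → C χ) (add : ∀ χ ψ, C χ → C ψ → C (χ + ψ)) : C χ := by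
  obtain ⟨d, hd⟩ : ∃ d : ℕ, χ 1 = d := by
    obtain ⟨d, ρ, rfl⟩ := h
    exact ⟨_, ρ.char_one⟩
  induction d using Nat.strong_induction_on generalizing χ with
  | _ d ih =>
    by_cases h0 : χ = 0
    · exact h0 ▸ zero
    by_cases hirr : IsIrrChar χ
    · exact irr χ hirr
    obtain ⟨χ₁, χ₂, h₁, h₂, h₁0, h₂0, rfl⟩ := h.exists_add_of_not_isIrrChar h0 hirr
    have h₁1 := h₁.apply_one_ne_zero h₁0
    have h₂1 := h₂.apply_one_ne_zero h₂0
    obtain ⟨d₁, hd₁⟩ : ∃ d : ℕ, χ₁ 1 = d := let ⟨_, ρ, h⟩ := h₁; ⟨_, h ▸ ρ.char_one⟩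
    obtain ⟨d₂, hd₂⟩ : ∃ d : ℕ, χ₂ 1 = d := let ⟨_, ρ, h⟩ := h₂; ⟨_, h ▸ ρ.char_one⟩
    rw [hd₁, Nat.cast_ne_zero] at h₁1
    rw [hd₂, Nat.cast_ne_zero] at h₂1
    have hsum : d₁ + d₂ = d := by
      rw [Pi.add_apply, hd₁, hd₂] at hd
      exact_mod_cast hd
    exact add _ _ (ih d₁ (by omega) h₁ hd₁) (ih d₂ (by omega) h₂ hd₂)

theorem IsChar.exists_eq_sum_irr [Finite G] {χ : G → ℂ} (h : IsChar χ) :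
    ∃ (n : ℕ) (ψ : Fin n → Irr G), χ = ∑ i, (ψ i).1 := by
  refine h.induction (C := fun χ => ∃ (n : ℕ) (ψ : Fin n → Irr G), χ = ∑ i, (ψ i).1)
    ⟨0, Fin.elim0, by simp⟩ (fun ψ hψ => ⟨1, fun _ => ⟨ψ, hψ⟩, by simp⟩) ?_
  rintro _ _ ⟨n₁, ψ₁, rfl⟩ ⟨n₂, ψ₂, rfl⟩
  exact ⟨n₁ + n₂, Fin.append ψ₁ ψ₂, by simp [Fin.sum_univ_add]⟩

theorem IsIrrChar.exists_eq_monoidHom [IsMulCommutative G] {χ : G → ℂ} (h : IsIrrChar χ) :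
    ∃ f : G →* ℂ, χ = f := by
  obtain ⟨d, ρ, hρ, rfl⟩ := h
  obtain rfl : d = 1 := by
    simpa using Representation.IsIrreducible.finrank_eq_one_of_isMulCommutative ρ
  refine ⟨LinearMap.det.comp ρ, funext fun g => ?_⟩
  simp [Representation.character, LinearMap.trace_eq_matrix_trace ℂ (Pi.basisFun ℂ (Fin 1)),
    ← LinearMap.det_toMatrix (Pi.basisFun ℂ (Fin 1)), Matrix.trace_fin_one]

theorem map_inv_eq_star [Finite G] (f : G →* ℂ) (g : G) : f g⁻¹ = star (f g) := by
  have hnorm : ‖f g‖ = 1 := by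
    refine Complex.norm_eq_one_of_pow_eq_one ?_ (Nat.card_pos (α := G)).ne'
    rw [← map_pow, pow_card_eq_one', map_one]
  have hinv : f g⁻¹ * f g = 1 := by rw [← map_mul, inv_mul_cancel, map_one]
  rw [eq_inv_of_mul_eq_one_left hinv, Complex.inv_eq_conj hnorm]
  rfl

-- Restricted to the cyclic group generated by `g`, the character is a sum of linear characters.
theorem IsChar.apply_inv [Finite G] {χ : G → ℂ} (h : IsChar χ) (g : G) :
    χ g⁻¹ = star (χ g) := by
  suffices ∀ x : Subgroup.zpowers g, (χ ∘ (Subgroup.zpowers g).subtype) x⁻¹ =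
      star ((χ ∘ (Subgroup.zpowers g).subtype) x) from this ⟨g, Subgroup.mem_zpowers g⟩
  refine (h.comp_hom (Subgroup.zpowers g).subtype).induction (C := fun ψ => ∀ x, ψ x⁻¹ = star (ψ x))
    (by simp) (fun ψ hψ => ?_) fun ψ₁ ψ₂ h₁ h₂ x => by
      rw [Pi.add_apply, h₁, h₂, Pi.add_apply, star_add]
  obtain ⟨f, rfl⟩ := hψ.exists_eq_monoidHom
  exact map_inv_eq_star f

end Characters

section CharForm

variable {G : Type*} [Group G] [Fintype G]

/-- The symmetric bilinear form `[χ, ψ] = |G|⁻¹ ∑ χ(g) ψ(g⁻¹)` on functions on `G`. On characters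
it agrees with the Hermitian inner product, since `ψ(g⁻¹)` is the complex conjugate of `ψ(g)`. -/
noncomputable def charForm : LinearMap.BilinForm ℂ (G → ℂ) :=
  LinearMap.mk₂ ℂ (fun χ ψ => (Nat.card G : ℂ)⁻¹ * ∑ g, χ g * ψ g⁻¹)
    (fun χ χ' ψ => by simp [add_mul, Finset.sum_add_distrib, mul_add])
    (fun c χ ψ => by simp only [Pi.smul_apply, smul_eq_mul, mul_assoc, ← Finset.mul_sum]; ring)
    (fun χ ψ ψ' => by simp [Finset.sum_add_distrib, mul_add])
    (fun c χ ψ => by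
      simp only [Pi.smul_apply, smul_eq_mul, mul_left_comm _ c, ← Finset.mul_sum])

theorem charForm_apply (χ ψ : G → ℂ) :
    charForm χ ψ = (Nat.card G : ℂ)⁻¹ * ∑ g, χ g * ψ g⁻¹ := rfl

theorem charForm_comm (χ ψ : G → ℂ) : charForm χ ψ = charForm ψ χ := by
  rw [charForm_apply, charForm_apply, ← Equiv.sum_comp (Equiv.inv G)]
  simp [mul_comm]

theorem natCast_card_ne_zero (G : Type*) [Group G] [Finite G] : (Nat.card G : ℂ) ≠ 0 :=
  Nat.cast_ne_zero.mpr Nat.card_pos.ne'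

theorem IsChar.exists_charForm_eq_natCast {χ ψ : G → ℂ} (h : IsChar χ) (h' : IsChar ψ) :
    ∃ n : ℕ, charForm χ ψ = n := by
  obtain ⟨d, ρ, rfl⟩ := h
  obtain ⟨e, σ, rfl⟩ := h'
  let _ := invertibleOfNonzero (natCast_card_ne_zero G)
  exact ⟨_, Representation.card_inv_mul_sum_char_mul_char_eq_finrank σ ρ⟩

open Classical in
theorem IsIrrChar.charForm_eq {χ ψ : G → ℂ} (h : IsIrrChar χ) (h' : IsIrrChar ψ) :
    charForm χ ψ = if χ = ψ then 1 else 0 := by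
  obtain ⟨d, ρ, hρ, rfl⟩ := h
  obtain ⟨e, σ, hσ, rfl⟩ := h'
  have : NeZero (Nat.card G : ℂ) := ⟨natCast_card_ne_zero G⟩
  let _ := invertibleOfNonzero (natCast_card_ne_zero G)
  have hiff : Nonempty (σ.Equiv ρ) ↔ ρ.character = σ.character :=
    ⟨fun ⟨e⟩ => (Representation.char_iso e).symm, fun h => nonempty_equiv_of_character_eq h.symm⟩
  rw [charForm_apply, Representation.char_orthonormal ρ σ]
  exact if_congr hiff rfl rfl

theorem IsIrrChar.charForm_self {χ : G → ℂ} (h : IsIrrChar χ) : charForm χ χ = 1 := by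
  rw [h.charForm_eq h, if_pos rfl]

theorem IsIrrChar.eq_of_charForm_ne_zero {χ ψ : G → ℂ} (h : IsIrrChar χ) (h' : IsIrrChar ψ)
    (hne : charForm χ ψ ≠ 0) : χ = ψ := by
  by_contra hχψ
  exact hne (by rw [h.charForm_eq h', if_neg hχψ])

theorem charForm_self_eq_ofReal {f : G → ℂ} (hf : ∀ g, f g⁻¹ = star (f g)) :
    charForm f f = (((Nat.card G : ℝ)⁻¹ * ∑ g, Complex.normSq (f g) : ℝ) : ℂ) := by
  simp [charForm_apply, hf, Complex.mul_conj]

theorem charForm_self_ne_zero {f : G → ℂ} (hf : ∀ g, f g⁻¹ = star (f g)) (h0 : f ≠ 0) :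
    charForm f f ≠ 0 := by
  obtain ⟨g, hg⟩ := Function.ne_iff.mp h0
  rw [charForm_self_eq_ofReal hf, Complex.ofReal_ne_zero]
  refine mul_ne_zero (by simp) (Finset.sum_pos' (fun _ _ => Complex.normSq_nonneg _)
    ⟨g, Finset.mem_univ g, Complex.normSq_pos.mpr hg⟩).ne'

theorem IsChar.exists_irr_charForm_ne_zero {χ : G → ℂ} (h : IsChar χ) (h0 : χ ≠ 0) :
    ∃ ψ : Irr G, charForm χ ψ.1 ≠ 0 := by
  obtain ⟨n, ψ, hψ⟩ := h.exists_eq_sum_irr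
  have hne : ∑ i, charForm χ (ψ i).1 ≠ 0 := by
    rw [← map_sum, ← hψ]
    exact charForm_self_ne_zero h.apply_inv h0
  obtain ⟨i, -, hi⟩ := Finset.exists_ne_zero_of_sum_ne_zero hne
  exact ⟨ψ i, hi⟩

theorem IsIrrChar.eq_of_charForm_eq_natCast {χ f : G → ℂ} (h : IsIrrChar χ)
    (hf : ∀ g, f g⁻¹ = star (f g)) (hff : charForm f f = 1) {n : ℕ} (hn : n ≠ 0)
    (hχf : charForm χ f = n) : χ = f := by
  by_contra hne
  have hsub : ∀ g, (χ - f) g⁻¹ = star ((χ - f) g) := by simp [h.isChar.apply_inv, hf]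
  have hform : charForm (χ - f) (χ - f) = ((2 - 2 * n : ℝ) : ℂ) := by
    simp only [map_sub, LinearMap.sub_apply, h.charForm_self, hff, charForm_comm f χ, hχf]
    push_cast
    ring
  have hne0 := charForm_self_ne_zero hsub (sub_ne_zero.mpr hne)
  have hreal := charForm_self_eq_ofReal hsub
  rw [hform, Complex.ofReal_inj] at hreal
  have hnonneg : (0 : ℝ) ≤ 2 - 2 * n :=
    hreal ▸ mul_nonneg (by positivity) (Finset.sum_nonneg fun g _ => Complex.normSq_nonneg _)
  have hn1 : (1 : ℝ) ≤ n := by exact_mod_cast Nat.one_le_iff_ne_zero.mpr hn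
  rw [hform, Complex.ofReal_ne_zero] at hne0
  exact hne0 (by linarith)

theorem IsChar.charForm_comp_self_ne_zero {H : Type*} [Group H] {χ : H → ℂ} (h : IsChar χ)
    (h0 : χ ≠ 0) (f : G →* H) : charForm (χ ∘ f) (χ ∘ f) ≠ 0 :=
  charForm_self_ne_zero (h.comp_hom f).apply_inv fun hf =>
    h.apply_one_ne_zero h0 (by simpa using congrFun hf 1)

theorem IsChar.isIrrChar_of_charForm_comp_eq_one {H : Type*} [Group H] [Finite H] {χ : H → ℂ}
    (h : IsChar χ) (f : G →* H) (hf : charForm (χ ∘ f) (χ ∘ f) = 1) : IsIrrChar χ := by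
  by_contra hirr
  have h0 : χ ≠ 0 := by
    rintro rfl
    simp at hf
  obtain ⟨χ₁, χ₂, h₁, h₂, h₁0, h₂0, rfl⟩ := h.exists_add_of_not_isIrrChar h0 hirr
  have hn₁ := h₁.charForm_comp_self_ne_zero h₁0 f
  have hn₂ := h₂.charForm_comp_self_ne_zero h₂0 f
  have hc₁ := h₁.comp_hom f
  have hc₂ := h₂.comp_hom f
  obtain ⟨a, ha⟩ := hc₁.exists_charForm_eq_natCast hc₁
  obtain ⟨b, hb⟩ := hc₁.exists_charForm_eq_natCast hc₂
  obtain ⟨c, hc⟩ := hc₂.exists_charForm_eq_natCast hc₂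
  have hsum : charForm ((χ₁ + χ₂) ∘ f) ((χ₁ + χ₂) ∘ f) = ((a + b + (b + c) : ℕ) : ℂ) := by
    rw [Pi.add_comp]
    simp only [map_add, LinearMap.add_apply, charForm_comm (χ₂ ∘ f) (χ₁ ∘ f), ha, hb, hc]
    push_cast
    ring
  rw [ha, Nat.cast_ne_zero] at hn₁
  rw [hc, Nat.cast_ne_zero] at hn₂
  rw [hsum, Nat.cast_eq_one] at hf
  omega

end CharForm

section DirectProducts

open Module

theorem isChar_single_one (G : Type*) [Group G] [Finite G] [DecidableEq G] :
    IsChar (Pi.single 1 (Nat.card G) : G → ℂ) := by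
  have := Fintype.ofFinite G
  let ρ : Representation ℂ G (G → ℂ) :=
    { toFun := fun g => LinearMap.funLeft ℂ ℂ fun x => x * g
      map_one' := by ext; simp [LinearMap.funLeft_apply]
      map_mul' := fun a b => by ext; simp [LinearMap.funLeft_apply, mul_assoc] }
  suffices h : ρ.character = Pi.single 1 (Nat.card G) from h ▸ isChar_character ρ
  funext g
  have hdiag : ∀ x, (LinearMap.toMatrix (Pi.basisFun ℂ G) (Pi.basisFun ℂ G) (ρ g)).diag x =
      if g = 1 then 1 else 0 := fun x => by
    simp [ρ, LinearMap.funLeft_apply, Pi.single_apply]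
  rw [Representation.character, LinearMap.trace_eq_matrix_trace ℂ (Pi.basisFun ℂ G), Matrix.trace,
    Fintype.sum_congr _ _ hdiag]
  simp [Pi.single_apply]

variable {ι : Type*} [Fintype ι] {G : ι → Type*}

/-- The product `(xᵢ) ↦ ∏ χᵢ(xᵢ)` of functions on the factors of a direct product. -/
def piProd (χ : ∀ i, G i → ℂ) (x : ∀ i, G i) : ℂ := ∏ i, χ i (x i)

theorem piProd_sum [DecidableEq ι] {κ : ι → Type*} [∀ i, Fintype (κ i)]
    (χ : ∀ i, κ i → G i → ℂ) :
    piProd (fun i => ∑ k, χ i k) = ∑ k : ∀ i, κ i, piProd fun i => χ i (k i) := by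
  funext x
  simp only [piProd, Finset.sum_apply]
  rw [Finset.prod_univ_sum, Fintype.piFinset_univ]

theorem piProd_single [∀ i, DecidableEq (G i)] (a : ∀ i, G i) (c : ι → ℂ) :
    piProd (fun i => Pi.single (a i) (c i)) = Pi.single a (∏ i, c i) := by
  funext x
  by_cases h : x = a
  · simp [h, piProd]
  obtain ⟨i, hi⟩ := Function.ne_iff.mp h
  rw [Pi.single_eq_of_ne h]
  exact Finset.prod_eq_zero (Finset.mem_univ i) (Pi.single_eq_of_ne hi _)

variable [∀ i, Group (G i)]

theorem isChar_piProd {χ : ∀ i, G i → ℂ} (h : ∀ i, IsChar (χ i)) : IsChar (piProd χ) := by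
  have hprod : piProd χ = ∏ i, χ i ∘ Pi.evalMonoidHom G i := by
    funext x
    simp [piProd]
  exact hprod ▸ IsChar.prod Finset.univ fun i => (h i).comp_hom (Pi.evalMonoidHom G i)

theorem charForm_piProd [DecidableEq ι] [∀ i, Fintype (G i)] (χ ψ : ∀ i, G i → ℂ) :
    charForm (piProd χ) (piProd ψ) = ∏ i, charForm (χ i) (ψ i) := by
  simp only [charForm_apply, piProd, Nat.card_pi, Nat.cast_prod, Pi.inv_apply,
    ← Finset.prod_mul_distrib]
  rw [Finset.prod_mul_distrib, Finset.prod_inv_distrib, Finset.prod_univ_sum, Fintype.piFinset_univ]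

theorem isIrrChar_piProd [∀ i, Finite (G i)] {χ : ∀ i, G i → ℂ} (h : ∀ i, IsIrrChar (χ i)) :
    IsIrrChar (piProd χ) := by
  classical
  have := fun i => Fintype.ofFinite (G i)
  refine (isChar_piProd fun i => (h i).isChar).isIrrChar_of_charForm_comp_eq_one (MonoidHom.id _) ?_
  rw [MonoidHom.coe_id, Function.comp_id, charForm_piProd]
  exact Finset.prod_eq_one fun i _ => (h i).charForm_self

theorem piProd_injective [∀ i, Finite (G i)] :
    Function.Injective fun χ : ∀ i, Irr (G i) => piProd fun i => (χ i).1 := by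
  classical
  have := fun i => Fintype.ofFinite (G i)
  intro χ ψ (h : piProd (fun i => (χ i).1) = piProd fun i => (ψ i).1)
  have hform : charForm (piProd fun i => (χ i).1) (piProd fun i => (ψ i).1) ≠ 0 := by
    rw [← h, (isIrrChar_piProd fun i => (χ i).2).charForm_self]
    exact one_ne_zero
  rw [charForm_piProd, Finset.prod_ne_zero_iff] at hform
  exact funext fun i =>
    Subtype.ext ((χ i).2.eq_of_charForm_ne_zero (ψ i).2 (hform i (Finset.mem_univ i)))

-- The product of the regular characters is the regular character, which has every irreducible
-- character as a constituent.
theorem IsIrrChar.exists_eq_piProd [∀ i, Finite (G i)] {χ : (∀ i, G i) → ℂ} (h : IsIrrChar χ) :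
    ∃ ψ : ∀ i, Irr (G i), χ = piProd fun i => (ψ i).1 := by
  classical
  have := fun i => Fintype.ofFinite (G i)
  choose n ψ hψ using fun i => (isChar_single_one (G i)).exists_eq_sum_irr
  have hreg : (Pi.single 1 (∏ i, (Nat.card (G i) : ℂ)) : (∀ i, G i) → ℂ) =
      ∑ k : ∀ i, Fin (n i), piProd fun i => (ψ i (k i)).1 := by
    rw [← piProd_single]
    exact (congrArg piProd (funext hψ)).trans (piProd_sum fun i k => (ψ i k).1)
  have hform : charForm χ (Pi.single 1 (∏ i, (Nat.card (G i) : ℂ))) ≠ 0 := by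
    have hprod : ∏ i, (Nat.card (G i) : ℂ) ≠ 0 :=
      Finset.prod_ne_zero_iff.mpr fun i _ => natCast_card_ne_zero (G i)
    rw [charForm_apply, Finset.sum_eq_single 1 (fun x _ hx => by
      rw [Pi.single_eq_of_ne (inv_ne_one.mpr hx), mul_zero]) (by simp), inv_one, Pi.single_eq_same]
    exact mul_ne_zero (inv_ne_zero (natCast_card_ne_zero _)) (mul_ne_zero h.apply_one_ne_zero hprod)
  rw [hreg, map_sum] at hform
  obtain ⟨k, -, hk⟩ := Finset.exists_ne_zero_of_sum_ne_zero hform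
  exact ⟨fun i => ψ i (k i), h.eq_of_charForm_ne_zero (isIrrChar_piProd fun i => (ψ i (k i)).2) hk⟩

end DirectProducts

section TensorPower

open Module

theorem trace_piTensorProduct_map {ι R : Type*} [Fintype ι] [CommRing R] {V : ι → Type*}
    [∀ i, AddCommGroup (V i)] [∀ i, Module R (V i)] [∀ i, Module.Free R (V i)]
    [∀ i, Module.Finite R (V i)] (f : ∀ i, V i →ₗ[R] V i) :
    LinearMap.trace R _ (PiTensorProduct.map f) = ∏ i, LinearMap.trace R (V i) (f i) := by
  classical
  have hb := fun i => Free.chooseBasis R (V i)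
  simp only [LinearMap.trace_eq_matrix_trace R (hb _),
    LinearMap.trace_eq_matrix_trace R (Basis.piTensorProduct hb), Matrix.trace,
    Finset.prod_univ_sum, Fintype.piFinset_univ]
  refine Finset.sum_congr rfl fun x _ => ?_
  simp [LinearMap.toMatrix_apply, PiTensorProduct.map_tprod]

variable {G V : Type*} [Group G] [AddCommGroup V] [Module ℂ V] {p : ℕ}

theorem wreathTensor_tprod (ρ : Representation ℂ G V) (f : Fin p → G) (s : Perm (Fin p))
    (v : Fin p → V) :
    wreathTensor ρ f s (PiTensorProduct.tprod ℂ v) =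
      PiTensorProduct.tprod ℂ fun i => ρ (f i) (v (s⁻¹ i)) := by
  simp [wreathTensor, PiTensorProduct.map_tprod, Perm.inv_def]

theorem wreathTensor_mul (ρ : Representation ℂ G V) (f g : Fin p → G) (s t : Perm (Fin p)) :
    wreathTensor ρ f s * wreathTensor ρ g t =
      wreathTensor ρ (fun i => f i * g (s⁻¹ i)) (s * t) := by
  refine PiTensorProduct.ext (MultilinearMap.ext fun v => ?_)
  simp [wreathTensor_tprod]

theorem wreathTensor_one (ρ : Representation ℂ G V) :
    wreathTensor ρ (1 : Fin p → G) 1 = 1 := by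
  refine PiTensorProduct.ext (MultilinearMap.ext fun v => ?_)
  simp [wreathTensor_tprod]

theorem trace_wreathTensor_base [FiniteDimensional ℂ V] (ρ : Representation ℂ G V)
    (f : Fin p → G) :
    LinearMap.trace ℂ _ (wreathTensor ρ f 1) = ∏ i, ρ.character (f i) := by
  have hmap : wreathTensor ρ f 1 = PiTensorProduct.map fun i => ρ (f i) := by
    refine PiTensorProduct.ext (MultilinearMap.ext fun v => ?_)
    simp [wreathTensor_tprod, PiTensorProduct.map_tprod]
  rw [hmap, trace_piTensorProduct_map]
  rfl

theorem trace_wreathTensor_equiv {W : Type*} [AddCommGroup W] [Module ℂ W]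
    {ρ : Representation ℂ G V} {σ : Representation ℂ G W} (e : ρ.Equiv σ) (f : Fin p → G)
    (s : Perm (Fin p)) :
    LinearMap.trace ℂ _ (wreathTensor σ f s) = LinearMap.trace ℂ _ (wreathTensor ρ f s) := by
  have hσ : ∀ g w, σ g w = e (ρ g (e.symm w)) := fun g w => by
    simpa using (e.toIntertwiningMap.isIntertwining _ _ g (e.symm w)).symm
  rw [← LinearMap.trace_conj' (wreathTensor ρ f s)
    (PiTensorProduct.congr fun _ => e.toLinearEquiv)]
  congr 1
  refine PiTensorProduct.ext (MultilinearMap.ext fun v => ?_)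
  simp [wreathTensor_tprod, LinearEquiv.conj_apply, PiTensorProduct.congr_tprod, hσ]
  rfl

theorem trace_wreathTensor_conj (ρ : Representation ℂ G V) (f : Fin p → G)
    (s m : Perm (Fin p)) :
    LinearMap.trace ℂ _ (wreathTensor ρ (fun i => f (m i)) (m⁻¹ * s * m)) =
      LinearMap.trace ℂ _ (wreathTensor ρ f s) := by
  have hinv : wreathTensor ρ 1 m * wreathTensor ρ 1 m⁻¹ = 1 := by
    rw [wreathTensor_mul, mul_inv_cancel, ← wreathTensor_one ρ]
    simp [Pi.one_def]
  have hconj : wreathTensor ρ (fun i => f (m i)) (m⁻¹ * s * m) =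
      wreathTensor ρ 1 m⁻¹ * wreathTensor ρ f s * wreathTensor ρ 1 m := by
    simp [wreathTensor_mul]
  rw [hconj, LinearMap.trace_mul_comm, ← mul_assoc, hinv, one_mul]

end TensorPower

/-! ### The group `P_p`, its linear characters and the normalizing permutations `mulPerm u` -/

theorem mem_normalizer_of_inv_mul_mul_mem {G : Type*} [Group G] {H : Subgroup G} [Finite H] {h : G}
    (hH : ∀ x ∈ H, h⁻¹ * x * h ∈ H) : h ∈ Subgroup.normalizer (H : Set G) := by
  have : Finite (H : Set G) := ‹Finite H›
  exact inv_mem_iff.mp (Subgroup.mem_normalizer_fintype (by simpa using hH))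

section Cyclic

variable {p : ℕ} [Fact p.Prime]

theorem mem_cyc_iff {s : Perm (Fin p)} : s ∈ cyc p ↔ ∃ c, s = finCycle c := by
  constructor
  · intro hs
    obtain ⟨m, rfl⟩ := mem_powers_iff_mem_zpowers.mpr hs
    induction m with
    | zero => exact ⟨0, by ext; simp⟩
    | succ m ih =>
      obtain ⟨c, hc⟩ := ih (pow_mem (Subgroup.mem_zpowers _) m)
      exact ⟨c + 1, Equiv.ext fun i => by simp_all [pow_succ', add_assoc]⟩
  · rintro ⟨c, rfl⟩
    have hc : finCycle c = finRotate p ^ (c : ℕ) :=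
      DFunLike.coe_injective (finCycle_eq_finRotate_iterate.trans (Perm.coe_pow _ _).symm)
    exact hc ▸ pow_mem (Subgroup.mem_zpowers _) _

theorem cyc_apply (s : cyc p) (i : Fin p) : (s : Perm (Fin p)) i = i + (s : Perm (Fin p)) 0 := by
  obtain ⟨c, hc⟩ := mem_cyc_iff.mp s.2
  simp [hc]

/-- The bijection `s ↦ s(0)`: a rotation is determined by the image of the first point. -/
def cycEquiv : cyc p ≃ Fin p where
  toFun s := (s : Perm (Fin p)) 0
  invFun c := ⟨finCycle c, mem_cyc_iff.mpr ⟨c, rfl⟩⟩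
  left_inv s := by
    ext i
    simp [cyc_apply s i]
  right_inv c := by simp

theorem cyc_ext {s t : cyc p} (h : (s : Perm (Fin p)) 0 = (t : Perm (Fin p)) 0) : s = t :=
  cycEquiv.injective h

theorem cyc_mul_comm (s t : cyc p) : s * t = t * s :=
  cyc_ext (by
    simp [cyc_apply s ((t : Perm (Fin p)) 0), cyc_apply t ((s : Perm (Fin p)) 0), add_comm])

theorem nat_card_cyc : Nat.card (cyc p) = p := by
  rw [Nat.card_congr cycEquiv, Nat.card_fin]

theorem eq_of_comp_cyc_eq {α : Type*} {f : Fin p → α} {s : cyc p} (hs : s ≠ 1)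
    (h : ∀ i, f ((s : Perm (Fin p)) i) = f i) (i j : Fin p) : f i = f j := by
  have hpow : ∀ (m : ℕ) i, f (((s ^ m : cyc p) : Perm (Fin p)) i) = f i := by
    intro m
    induction m with
    | zero => exact fun i => rfl
    | succ m ih => exact fun i => (ih _).trans (h i)
  obtain ⟨m, hm⟩ := mem_powers_of_prime_card (g' := cycEquiv.symm (j - i)) nat_card_cyc hs
  have hji : ((s ^ m : cyc p) : Perm (Fin p)) i = j := by
    rw [show s ^ m = _ from hm]
    simp [cycEquiv]
  rw [← hpow m i, hji]

theorem phi_mul (ε : Fin p) (s t : cyc p) : phi ε (s * t) = phi ε s * phi ε t := by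
  have hω : (Complex.exp (2 * Real.pi * Complex.I / p) ^ (ε : ℕ)) ^ p = 1 := by
    rw [pow_right_comm, (Complex.isPrimitiveRoot_exp p (NeZero.ne p)).pow_eq_one, one_pow]
  unfold phi
  rw [← pow_add, ← mul_add, pow_mul, pow_mul, Subgroup.coe_mul, Perm.mul_apply, cyc_apply,
    Fin.val_add, ← pow_eq_pow_mod _ hω, add_comm]

theorem phi_one (ε : Fin p) : phi ε (1 : cyc p) = 1 := by simp [phi]

theorem isPrimitiveRoot_exp_pow {s : cyc p} (hs : s ≠ 1) :
    IsPrimitiveRoot (Complex.exp (2 * Real.pi * Complex.I / p) ^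
      (((s : Perm (Fin p)) 0 : Fin p) : ℕ)) p := by
  have h0 : (((s : Perm (Fin p)) 0 : Fin p) : ℕ) ≠ 0 := fun h =>
    hs (cyc_ext (by simpa using Fin.ext h))
  exact (Complex.isPrimitiveRoot_exp p (NeZero.ne p)).pow_of_coprime _
    ((Nat.coprime_of_lt_prime h0 ((s : Perm (Fin p)) 0).isLt Fact.out).symm)

theorem phi_eq_pow (ε : Fin p) (s : cyc p) :
    phi ε s = (Complex.exp (2 * Real.pi * Complex.I / p) ^
      (((s : Perm (Fin p)) 0 : Fin p) : ℕ)) ^ (ε : ℕ) := by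
  rw [phi, ← pow_mul, mul_comm (ε : ℕ)]

theorem sum_phi {s : cyc p} (hs : s ≠ 1) : ∑ ε : Fin p, phi ε s = 0 := by
  simp only [phi_eq_pow]
  rw [Fin.sum_univ_eq_sum_range]
  exact (isPrimitiveRoot_exp_pow hs).geom_sum_eq_zero (Fact.out : p.Prime).one_lt

theorem phi_injective {ε ε' : Fin p} {s : cyc p} (hs : s ≠ 1) (h : phi ε s = phi ε' s) :
    ε = ε' := by
  rw [phi_eq_pow, phi_eq_pow] at h
  exact Fin.ext ((isPrimitiveRoot_exp_pow hs).pow_inj ε.isLt ε'.isLt h)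

theorem residue_apply (i : Fin p) : residue p i = ((i : ℕ) : ZMod p) + 1 := by
  obtain ⟨n, rfl⟩ : ∃ n, p = n + 1 := Nat.exists_eq_add_one.mpr (NeZero.pos p)
  exact congrArg (· + 1) (ZMod.natCast_zmod_val (n := n + 1) i).symm

theorem residue_mulPerm (u : (ZMod p)ˣ) (i : Fin p) :
    residue p (mulPerm u i) = u * residue p i := by
  simp [mulPerm, Equiv.permCongr_apply]

theorem mulPerm_inv (u : (ZMod p)ˣ) : (mulPerm u)⁻¹ = mulPerm (p := p) u⁻¹ := by
  refine inv_eq_of_mul_eq_one_left (Equiv.ext fun i => (residue p).injective ?_)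
  rw [Perm.mul_apply, residue_mulPerm, residue_mulPerm, Units.inv_mul_cancel_left, Perm.one_apply]

theorem residue_cyc (s : cyc p) (i : Fin p) :
    residue p ((s : Perm (Fin p)) i) =
      residue p i + (((s : Perm (Fin p)) 0 : Fin p) : ℕ) := by
  rw [residue_apply, residue_apply, cyc_apply, Fin.val_add, ZMod.natCast_mod]
  push_cast
  ring

theorem mem_cyc_of_residue {s : Perm (Fin p)} (c : ZMod p)
    (h : ∀ i, residue p (s i) = residue p i + c) : s ∈ cyc p := by
  refine mem_cyc_iff.mpr ⟨(ZMod.finEquiv p).symm c, Equiv.ext fun i => (residue p).injective ?_⟩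
  rw [h]
  simp [residue, add_right_comm]

theorem residue_mulPerm_conj (u : (ZMod p)ˣ) (s : cyc p) (i : Fin p) :
    residue p (((mulPerm u)⁻¹ * (s : Perm (Fin p)) * mulPerm u) i) = residue p i +
      ((u⁻¹ : (ZMod p)ˣ) : ZMod p) * (((s : Perm (Fin p)) 0 : Fin p) : ℕ) := by
  rw [mulPerm_inv, Perm.mul_apply, Perm.mul_apply, residue_mulPerm, residue_cyc, residue_mulPerm,
    mul_add, Units.inv_mul_cancel_left]

theorem mulPerm_mem_normalizer (u : (ZMod p)ˣ) :
    mulPerm u ∈ Subgroup.normalizer (cyc p : Set (Perm (Fin p))) :=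
  mem_normalizer_of_inv_mul_mul_mem fun s hs =>
    mem_cyc_of_residue _ (residue_mulPerm_conj u ⟨s, hs⟩)

/-- The permutation `τ` on the labels `0, …, p - 1`, without the fixed label `p` of `tauLabel`. -/
def tauFin (u : (ZMod p)ˣ) (ε : Fin p) : Fin p :=
  ⟨(((u⁻¹ : (ZMod p)ˣ) : ZMod p) * ((ε : ℕ) : ZMod p)).val, ZMod.val_lt _⟩

theorem tauLabel_castSucc (u : (ZMod p)ˣ) (ε : Fin p) :
    tauLabel u ε.castSucc = (tauFin u ε).castSucc := by
  rw [tauLabel, if_neg (Fin.castSucc_lt_last ε).ne]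
  rfl

theorem phi_conj_mulPerm (u : (ZMod p)ˣ) (ε : Fin p) (s : cyc p) :
    phi ε (conjEquiv (mulPerm_mem_normalizer u) s) = phi (tauFin u ε) s := by
  have hω := (Complex.isPrimitiveRoot_exp p (NeZero.ne p)).pow_eq_one
  have hs : (((conjEquiv (mulPerm_mem_normalizer u) s : Perm (Fin p)) 0 : Fin p) : ZMod p) =
      ((u⁻¹ : (ZMod p)ˣ) : ZMod p) * (((s : Perm (Fin p)) 0 : Fin p) : ℕ) := by
    have h := residue_mulPerm_conj u s 0
    rw [residue_apply, residue_apply, Fin.val_zero, Nat.cast_zero, zero_add, add_comm,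
      add_right_inj] at h
    exact h
  unfold phi
  rw [pow_eq_pow_mod _ hω, pow_eq_pow_mod (_ * _) hω]
  refine congrArg _ ((ZMod.natCast_eq_natCast_iff _ _ p).mp ?_)
  rw [Nat.cast_mul, Nat.cast_mul, hs, tauFin, ZMod.natCast_val, ZMod.cast_id', id_eq]
  ring

end Cyclic

/-! ### Elements of the wreath product `P_{p^(k+1)} = P_{p^k} ≀ P_p` -/

section Wreath

variable {p k : ℕ}

theorem wr_apply (f : Fin p → Perm (Fin (p ^ k))) (s : Perm (Fin p)) (i : Fin p)
    (r : Fin (p ^ k)) :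
    wr f s (blockEquiv p k (i, r)) = blockEquiv p k (s i, f (s i) r) := by
  simp [wr, Equiv.permCongr_apply, Equiv.prodShear]

theorem wr_inv (f : Fin p → Perm (Fin (p ^ k))) (s : Perm (Fin p)) :
    (wr f s)⁻¹ = wr (fun i => (f (s i))⁻¹) s⁻¹ := by
  rw [inv_eq_iff_mul_eq_one, wr_mul]
  simpa using! wr_one

theorem wr_conj (f : Fin p → Perm (Fin (p ^ k))) (s m : Perm (Fin p)) (h : Perm (Fin (p ^ k))) :
    (wr (fun _ => h) m)⁻¹ * wr f s * wr (fun _ => h) m =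
      wr (fun i => h⁻¹ * f (m i) * h) (m⁻¹ * s * m) := by
  rw [wr_inv, wr_mul, wr_mul]
  simp

/-- The embedding `f ↦ (f; 1)` of the base group of the full wreath product `S_{p^k} ≀ S_p`. -/
def wrBase (p k : ℕ) : (Fin p → Perm (Fin (p ^ k))) →* Perm (Fin (p ^ (k + 1))) where
  toFun f := wr f 1
  map_one' := wr_one
  map_mul' f g := by
    rw [wr_mul]
    rfl

/-- The embedding `s ↦ (1; s)` of the top group of the full wreath product `S_{p^k} ≀ S_p`. -/
def wrTop (p k : ℕ) : Perm (Fin p) →* Perm (Fin (p ^ (k + 1))) where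
  toFun s := wr 1 s
  map_one' := wr_one
  map_mul' s t := by
    rw [wr_mul]
    rfl

variable [Fact p.Prime]

theorem wr_injective {f g : Fin p → Perm (Fin (p ^ k))} {s t : Perm (Fin p)}
    (h : wr f s = wr g t) : f = g ∧ s = t := by
  have hpair : ∀ i r, (s i, f (s i) r) = (t i, g (t i) r) := fun i r => by
    apply (blockEquiv p k).injective
    rw [← wr_apply, ← wr_apply, h]
  obtain rfl : s = t := Equiv.ext fun i =>
    congrArg Prod.fst (hpair i ⟨0, Nat.pow_pos (NeZero.pos p)⟩)
  refine ⟨funext fun i => Equiv.ext fun r => ?_, rfl⟩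
  simpa using congrArg Prod.snd (hpair (s⁻¹ i) r)

theorem gen_mem {j : ℕ} (h1 : 1 ≤ j) (h2 : j ≤ k) : gen p k j ∈ P p k :=
  Subgroup.subset_closure ⟨j, h1, h2, rfl⟩

theorem wr_one_left_mem {s : Perm (Fin p)} (hs : s ∈ cyc p) :
    wr (1 : Fin p → Perm (Fin (p ^ k))) s ∈ P p (k + 1) := by
  have hle : cyc p ≤ (P p (k + 1)).comap (wrTop p k) := by
    rw [cyc, Subgroup.zpowers_le]
    simpa only [gen, if_true] using! gen_mem (p := p) (k := k + 1) (j := k + 1) (by omega) le_rfl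
  exact hle hs

theorem wr_mulSingle_zero_mem {h : Perm (Fin (p ^ k))} (hh : h ∈ P p k) :
    wr (Pi.mulSingle 0 h) 1 ∈ P p (k + 1) := by
  have hle : P p k ≤ (P p (k + 1)).comap ((wrBase p k).comp (MonoidHom.mulSingle _ 0)) := by
    refine (Subgroup.closure_le _).mpr ?_
    rintro _ ⟨j, h1, h2, rfl⟩
    have hgen := gen_mem (p := p) (k := k + 1) (j := j) h1 (by omega)
    rwa [gen, if_neg (by omega)] at hgen
  exact hle hh

theorem wr_mulSingle_mem (i : Fin p) {h : Perm (Fin (p ^ k))} (hh : h ∈ P p k) :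
    wr (Pi.mulSingle i h) 1 ∈ P p (k + 1) := by
  let s : cyc p := cycEquiv.symm (-i)
  have hsi : (s : Perm (Fin p)) i = 0 := by simp [s, cycEquiv]
  have hs : wr (fun _ => 1) s ∈ P p (k + 1) := wr_one_left_mem (k := k) s.2
  have hconj := mul_mem (mul_mem (inv_mem hs) (wr_mulSingle_zero_mem hh)) hs
  rw [wr_conj] at hconj
  convert hconj using 2
  · funext j
    simp [Pi.mulSingle_apply, ← hsi]
  · simp

theorem wr_mem {f : Fin p → Perm (Fin (p ^ k))} {s : Perm (Fin p)} (hf : ∀ i, f i ∈ P p k)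
    (hs : s ∈ cyc p) : wr f s ∈ P p (k + 1) := by
  have hbase : f ∈ (P p (k + 1)).comap (wrBase p k) :=
    Subgroup.pi_mem_of_mulSingle_mem f fun i => wr_mulSingle_mem i (hf i)
  have hmul : wr f 1 * wr 1 s ∈ P p (k + 1) := mul_mem hbase (wr_one_left_mem hs)
  rw [wr_mul] at hmul
  simpa using hmul

/-- The element `(f; s)` of `P_{p^(k+1)}` with components `f` and `s`; the inverse of
`x ↦ (base x, top x)`. -/
def wrMk (f : Fin p → P p k) (s : cyc p) : P p (k + 1) :=
  ⟨wr (fun i => (f i : Perm (Fin (p ^ k)))) s, wr_mem (fun i => (f i).2) s.2⟩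

theorem coe_wrMk (f : Fin p → P p k) (s : cyc p) :
    (wrMk f s : Perm (Fin (p ^ (k + 1)))) = wr (fun i => (f i : Perm (Fin (p ^ k)))) s := rfl

theorem wrMk_injective {f g : Fin p → P p k} {s t : cyc p} (h : wrMk f s = wrMk g t) :
    f = g ∧ s = t := by
  have hval := congrArg Subtype.val h
  rw [coe_wrMk, coe_wrMk] at hval
  obtain ⟨hfg, hst⟩ := wr_injective hval
  exact ⟨funext fun i => Subtype.ext (congrFun hfg i), Subtype.ext hst⟩

theorem wrMk_base_top (x : P p (k + 1)) : wrMk (base x) (top x) = x :=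
  Subtype.ext (exists_wr x.2).choose_spec.choose_spec.symm

@[simp] theorem base_wrMk (f : Fin p → P p k) (s : cyc p) : base (wrMk f s) = f :=
  (wrMk_injective (wrMk_base_top (wrMk f s))).1

@[simp] theorem top_wrMk (f : Fin p → P p k) (s : cyc p) : top (wrMk f s) = s :=
  (wrMk_injective (wrMk_base_top (wrMk f s))).2

theorem wrMk_mul (f g : Fin p → P p k) (s t : cyc p) :
    wrMk f s * wrMk g t = wrMk (fun i => f i * g ((s : Perm (Fin p))⁻¹ i)) (s * t) := by
  apply Subtype.ext
  simp only [Subgroup.coe_mul, coe_wrMk, wr_mul]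

theorem wrMk_one : wrMk (1 : Fin p → P p k) 1 = 1 := Subtype.ext wr_one

theorem wrMk_inv (f : Fin p → P p k) (s : cyc p) :
    (wrMk f s)⁻¹ = wrMk (fun i => (f ((s : Perm (Fin p)) i))⁻¹) s⁻¹ := by
  apply Subtype.ext
  simp only [Subgroup.coe_inv, coe_wrMk, wr_inv]

/-- The bijection `(f, s) ↦ (f; s)`. -/
noncomputable def wreathEquiv (p k : ℕ) [Fact p.Prime] :
    (Fin p → P p k) × cyc p ≃ P p (k + 1) where
  toFun x := wrMk x.1 x.2
  invFun x := (base x, top x)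
  left_inv x := by simp
  right_inv x := wrMk_base_top x

theorem nat_card_P_succ : Nat.card (P p (k + 1)) = Nat.card (Fin p → P p k) * p := by
  rw [← Nat.card_congr (wreathEquiv p k), Nat.card_prod, nat_card_cyc]

theorem nontrivial_P (hk : k ≠ 0) : Nontrivial (P p k) := by
  obtain ⟨k, rfl⟩ := Nat.exists_eq_succ_of_ne_zero hk
  have : Nontrivial (cyc p) := by
    rw [← Finite.one_lt_card_iff_nontrivial, nat_card_cyc]
    exact (Fact.out : p.Prime).one_lt
  exact (wreathEquiv p k).symm.nontrivial

/-- The embedding `f ↦ (f; 1)` of `(P_{p^k})^p` in `P_{p^(k+1)}`, that is, `baseHom` with values in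
`P_{p^(k+1)}`. -/
def baseInclusion (p k : ℕ) [Fact p.Prime] : (Fin p → P p k) →* P p (k + 1) where
  toFun f := wrMk f 1
  map_one' := wrMk_one
  map_mul' f g := by
    rw [wrMk_mul]
    rfl

theorem baseInclusion_apply (f : Fin p → P p k) : baseInclusion p k f = wrMk f 1 := rfl

theorem wrMk_mem_baseGroup {f : Fin p → P p k} {s : cyc p} :
    wrMk f s ∈ baseGroup (p := p) k ↔ s = 1 := by
  constructor
  · rintro ⟨g, hg⟩
    have hwr : wr (fun i => (g i : Perm (Fin (p ^ k)))) 1 =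
        wr (fun i => (f i : Perm (Fin (p ^ k)))) s := hg
    exact (Subtype.ext (wr_injective hwr).2).symm
  · rintro rfl
    exact ⟨f, rfl⟩

theorem mem_baseGroup_iff {x : P p (k + 1)} : x ∈ baseGroup (p := p) k ↔ top x = 1 := by
  rw [← wrMk_mem_baseGroup (f := base x), wrMk_base_top]

theorem nat_card_baseGroup : Nat.card (baseGroup (p := p) k) = Nat.card (Fin p → P p k) := by
  have hrange : baseGroup (p := p) k = (baseInclusion p k).range := by
    ext x
    rw [mem_baseGroup_iff]
    constructor
    · exact fun hx => ⟨base x, by rw [baseInclusion_apply, ← hx, wrMk_base_top]⟩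
    · rintro ⟨f, rfl⟩
      exact top_wrMk f 1
  rw [hrange]
  exact (Nat.card_congr (MonoidHom.ofInjective fun _ _ h => (wrMk_injective h).1).toEquiv).symm

section Normalizer

variable {h : Perm (Fin (p ^ k))} {m : Perm (Fin p)}
  (hh : h ∈ Subgroup.normalizer (P p k : Set (Perm (Fin (p ^ k)))))
  (hm : m ∈ Subgroup.normalizer (cyc p : Set (Perm (Fin p))))

include hh hm in
theorem wr_mem_normalizer :
    wr (fun _ => h) m ∈ Subgroup.normalizer (P p (k + 1) : Set (Perm (Fin (p ^ (k + 1))))) := by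
  refine mem_normalizer_of_inv_mul_mul_mem fun x hx => ?_
  obtain ⟨f, s, rfl⟩ := exists_wr hx
  rw [wr_conj]
  exact wr_mem (fun i => (conjEquiv hh (f (m i))).2) (conjEquiv hm s).2

theorem conjEquiv_wrMk (f : Fin p → P p k) (s : cyc p) :
    conjEquiv (wr_mem_normalizer hh hm) (wrMk f s) =
      wrMk (fun i => conjEquiv hh (f (m i))) (conjEquiv hm s) :=
  Subtype.ext (wr_conj _ _ _ _)

end Normalizer

theorem sigma_mem_normalizer (u : (ZMod p)ˣ) (k j : ℕ) :
    sigma u k j ∈ Subgroup.normalizer (P p k : Set (Perm (Fin (p ^ k)))) := by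
  induction k with
  | zero => exact one_mem _
  | succ k ih =>
    rw [sigma]
    split_ifs
    · exact wr_mem_normalizer (one_mem _) (mulPerm_mem_normalizer u)
    · exact wr_mem_normalizer ih (one_mem _)

end Wreath

/-! ### Irreducible characters of the wreath product -/

section WreathCharacters

variable {p : ℕ} [Fact p.Prime] {k : ℕ}

noncomputable instance fintypeP (p k : ℕ) [Fact p.Prime] : Fintype (P p k) := Fintype.ofFinite _

noncomputable instance fintypeCyc (p : ℕ) : Fintype (cyc p) := Fintype.ofFinite _

theorem card_cyc : Fintype.card (cyc p) = p := by
  rw [Fintype.card_eq_nat_card, nat_card_cyc]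

theorem inv_prime_mul_cancel (z : ℂ) : (p : ℂ)⁻¹ * (p * z) = z :=
  inv_mul_cancel_left₀ (Nat.cast_ne_zero.mpr (NeZero.ne p)) z

theorem sum_P_succ (F : P p (k + 1) → ℂ) : ∑ x, F x = ∑ f, ∑ s, F (wrMk f s) := by
  rw [← Equiv.sum_comp (wreathEquiv p k), Fintype.sum_prod_type]
  rfl

theorem induction_wrMk {C : P p (k + 1) → Prop} (h : ∀ f s, C (wrMk f s)) (x : P p (k + 1)) :
    C x := by
  rw [← wrMk_base_top x]
  exact h _ _

theorem charForm_of_eq_zero_off_base (χ : P p (k + 1) → ℂ) {ψ : P p (k + 1) → ℂ}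
    (h : ∀ f s, s ≠ 1 → ψ (wrMk f s) = 0) :
    charForm χ ψ = (p : ℂ)⁻¹ * charForm (χ ∘ baseInclusion p k) (ψ ∘ baseInclusion p k) := by
  rw [charForm_apply, charForm_apply, nat_card_P_succ, sum_P_succ, Nat.cast_mul, mul_inv,
    mul_comm (_⁻¹) (_⁻¹), mul_assoc]
  congr 2
  refine Finset.sum_congr rfl fun f _ => ?_
  rw [Finset.sum_eq_single 1]
  · rw [Function.comp_apply, Function.comp_apply, map_inv]
    rfl
  · intro s _ hs
    rw [wrMk_inv, h _ _ (inv_ne_one.mpr hs), mul_zero]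
  · simp

/-- The representation of `P_{p^(k+1)} = P_{p^k} ≀ P_p` on the tensor power of a representation of
`P_{p^k}`, multiplied by the inflation of `φ_ε`; it affords `𝒳(φ; ε)` if `ρ` affords `φ`. -/
noncomputable def wreathRep {V : Type*} [AddCommGroup V] [Module ℂ V]
    (ρ : Representation ℂ (P p k) V) (ε : Fin p) :
    Representation ℂ (P p (k + 1)) (PiTensorProduct ℂ fun _ : Fin p => V) where
  toFun x := phi ε (top x) • wreathTensor ρ (base x) (top x)
  map_one' := by
    rw [← wrMk_one, base_wrMk, top_wrMk, phi_one, one_smul]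
    exact wreathTensor_one ρ
  map_mul' x y := by
    induction x using induction_wrMk with | _ f s
    induction y using induction_wrMk with | _ g t
    rw [wrMk_mul]
    simp only [base_wrMk, top_wrMk, phi_mul, Subgroup.coe_mul]
    rw [smul_mul_smul_comm, wreathTensor_mul]

theorem isChar_calX (φ : Irr (P p k)) (ε : Fin p) : IsChar (calX φ ε) := by
  have hchar : calX φ ε = (wreathRep φ.2.choose_spec.choose ε).character := by
    funext x
    simp [calX, Representation.character, wreathRep, mul_comm]
  rw [hchar]
  exact isChar_character _

theorem calX_wrMk (φ : Irr (P p k)) (ε : Fin p) (f : Fin p → P p k) (s : cyc p) :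
    calX φ ε (wrMk f s) =
      LinearMap.trace ℂ _ (wreathTensor φ.2.choose_spec.choose f s) * phi ε s := by
  rw [calX, base_wrMk, top_wrMk]

theorem calX_comp_baseInclusion (φ : Irr (P p k)) (ε : Fin p) :
    calX φ ε ∘ baseInclusion p k = piProd fun _ : Fin p => φ.1 := by
  funext f
  rw [Function.comp_apply, baseInclusion_apply, calX_wrMk, phi_one, mul_one]
  conv_rhs => rw [φ.2.choose_spec.choose_spec.2]
  exact trace_wreathTensor_base _ _

theorem charForm_calX_comp_self (φ : Irr (P p k)) (ε : Fin p) :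
    charForm (calX φ ε ∘ baseInclusion p k) (calX φ ε ∘ baseInclusion p k) = 1 := by
  rw [calX_comp_baseInclusion]
  exact (isIrrChar_piProd fun _ : Fin p => φ.2).charForm_self

theorem isIrrChar_calX (φ : Irr (P p k)) (ε : Fin p) : IsIrrChar (calX φ ε) :=
  (isChar_calX φ ε).isIrrChar_of_charForm_comp_eq_one (baseInclusion p k)
    (charForm_calX_comp_self φ ε)

theorem exists_calX_wrMk_ne_zero (φ : Irr (P p k)) (ε : Fin p) :
    ∃ f s, s ≠ 1 ∧ calX φ ε (wrMk f s) ≠ 0 := by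
  by_contra! h
  have hform := charForm_of_eq_zero_off_base (calX φ ε) h
  rw [(isIrrChar_calX φ ε).charForm_self, charForm_calX_comp_self, mul_one, eq_comm,
    inv_eq_one, Nat.cast_eq_one] at hform
  exact (Fact.out : p.Prime).one_lt.ne' hform

theorem calX_injective {φ φ' : Irr (P p k)} {ε ε' : Fin p} (h : calX φ ε = calX φ' ε') :
    φ = φ' ∧ ε = ε' := by
  obtain rfl : φ = φ' := by
    have hbase := calX_comp_baseInclusion φ ε
    rw [h, calX_comp_baseInclusion] at hbase
    exact congrFun (piProd_injective (a₁ := fun _ : Fin p => φ) (a₂ := fun _ => φ') hbase.symm) 0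
  refine ⟨rfl, ?_⟩
  obtain ⟨f, s, hs, hne⟩ := exists_calX_wrMk_ne_zero φ ε
  have heval := congrFun h (wrMk f s)
  rw [calX_wrMk] at hne
  rw [calX_wrMk, calX_wrMk] at heval
  exact phi_injective hs (mul_left_cancel₀ (left_ne_zero_of_mul hne) heval)

theorem indProd_wrMk_of_ne (θs : Fin p → Irr (P p k)) (f : Fin p → P p k) {s : cyc p}
    (hs : s ≠ 1) : indProd θs (wrMk f s) = 0 := by
  rw [indProd, induced, finsum_eq_zero_of_forall_eq_zero, mul_zero]
  intro x
  induction x using induction_wrMk with | _ g t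
  rw [dif_neg]
  rwa [wrMk_inv, wrMk_mul, wrMk_mul, wrMk_mem_baseGroup, cyc_mul_comm t⁻¹ s, inv_mul_cancel_right]

theorem wrMk_one_conj (f g : Fin p → P p k) (t : cyc p) :
    (wrMk g t)⁻¹ * wrMk f 1 * wrMk g t =
      wrMk (fun i => (g ((t : Perm (Fin p)) i))⁻¹ * f ((t : Perm (Fin p)) i) *
        g ((t : Perm (Fin p)) i)) 1 := by
  rw [wrMk_inv, wrMk_mul, wrMk_mul]
  simp

theorem indProd_wrMk_one (θs : Fin p → Irr (P p k)) (f : Fin p → P p k) :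
    indProd θs (wrMk f 1) = ∑ t : cyc p, ∏ i, (θs i).1 (f ((t : Perm (Fin p)) i)) := by
  rw [indProd, induced, finsum_eq_sum_of_fintype, sum_P_succ, nat_card_baseGroup]
  simp only [wrMk_one_conj, wrMk_mem_baseGroup, dite_true, base_wrMk, (θs _).2.isChar.apply_conj]
  rw [Finset.sum_const, Finset.card_univ, Fintype.card_eq_nat_card, nsmul_eq_mul,
    inv_mul_cancel_left₀ (natCast_card_ne_zero _)]

theorem indProd_comp_baseInclusion (θs : Fin p → Irr (P p k)) :
    indProd θs ∘ baseInclusion p k =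
      ∑ t : cyc p, piProd fun i => (θs ((t : Perm (Fin p)) i)).1 := by
  funext f
  rw [Function.comp_apply, baseInclusion_apply, indProd_wrMk_one, Finset.sum_apply,
    ← Equiv.sum_comp (Equiv.inv (cyc p))]
  refine Finset.sum_congr rfl fun t _ => ?_
  rw [piProd, ← Equiv.prod_comp (t : Perm (Fin p))]
  simp

theorem indProd_inv (θs : Fin p → Irr (P p k)) (x : P p (k + 1)) :
    indProd θs x⁻¹ = star (indProd θs x) := by
  induction x using induction_wrMk with | _ f s
  rw [wrMk_inv]
  by_cases hs : s = 1
  · subst hs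
    simp only [inv_one, indProd_wrMk_one, star_sum, star_prod, ← (θs _).2.isChar.apply_inv]
    rfl
  · rw [indProd_wrMk_of_ne _ _ hs, indProd_wrMk_of_ne _ _ (inv_ne_one.mpr hs), star_zero]

-- `(1; t)` conjugates `(f; 1)` to the element of the base group with permuted components.
theorem charForm_comp_baseInclusion_piProd_perm {χ : P p (k + 1) → ℂ} (hχ : IsChar χ)
    (ψ : Fin p → P p k → ℂ) (t : cyc p) :
    charForm (χ ∘ baseInclusion p k) (piProd fun i => ψ ((t : Perm (Fin p)) i)) =
      charForm (χ ∘ baseInclusion p k) (piProd ψ) := by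
  rw [charForm_apply, charForm_apply,
    ← Equiv.sum_comp (Equiv.arrowCongr (t : Perm (Fin p)).symm (Equiv.refl (P p k)))]
  congr 1
  refine Finset.sum_congr rfl fun f _ => ?_
  have hconj : baseInclusion p k (Equiv.arrowCongr (t : Perm (Fin p)).symm (Equiv.refl _) f) =
      (wrMk 1 t)⁻¹ * baseInclusion p k f * wrMk 1 t := by
    rw [baseInclusion_apply f, wrMk_one_conj, baseInclusion_apply]
    simp [Equiv.arrowCongr, Function.comp_def]
  rw [Function.comp_apply, hconj, hχ.apply_conj, Function.comp_apply, piProd, piProd,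
    ← Equiv.prod_comp (t : Perm (Fin p)) fun i => ψ i (f⁻¹ i)]
  rfl

theorem charForm_indProd {χ : P p (k + 1) → ℂ} (hχ : IsChar χ) (θs : Fin p → Irr (P p k)) :
    charForm χ (indProd θs) = charForm (χ ∘ baseInclusion p k) (piProd fun i => (θs i).1) := by
  rw [charForm_of_eq_zero_off_base χ fun f s hs => indProd_wrMk_of_ne θs f hs,
    indProd_comp_baseInclusion, map_sum]
  simp only [charForm_comp_baseInclusion_piProd_perm hχ fun i => (θs i).1]
  rw [Finset.sum_const, Finset.card_univ, nsmul_eq_mul, card_cyc, inv_prime_mul_cancel]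

open Classical in
theorem charForm_piProd_perm {θs : Fin p → Irr (P p k)} (h : ¬ ∀ i j, θs i = θs j)
    (s t : cyc p) :
    charForm (piProd fun i => (θs ((s : Perm (Fin p)) i)).1)
      (piProd fun i => (θs ((t : Perm (Fin p)) i)).1) = if s = t then 1 else 0 := by
  rw [(isIrrChar_piProd fun i => (θs _).2).charForm_eq (isIrrChar_piProd fun i => (θs _).2)]
  refine if_congr ⟨fun hst => ?_, fun hst => by rw [hst]⟩ rfl rfl
  have hperm := piProd_injective (a₁ := fun i => θs ((s : Perm (Fin p)) i))
    (a₂ := fun i => θs ((t : Perm (Fin p)) i)) hst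
  by_contra hne
  refine h (eq_of_comp_cyc_eq (s := s * t⁻¹) (mul_inv_eq_one.not.mpr hne) fun i => ?_)
  simpa using congrFun hperm ((t : Perm (Fin p))⁻¹ i)

theorem charForm_indProd_self {θs : Fin p → Irr (P p k)} (h : ¬ ∀ i j, θs i = θs j) :
    charForm (indProd θs) (indProd θs) = 1 := by
  classical
  rw [charForm_of_eq_zero_off_base _ fun f s hs => indProd_wrMk_of_ne θs f hs,
    indProd_comp_baseInclusion]
  simp only [map_sum, LinearMap.sum_apply, charForm_piProd_perm h, Finset.sum_ite_eq',
    Finset.mem_univ, if_true]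
  rw [Finset.sum_const, Finset.card_univ, nsmul_eq_mul, card_cyc, inv_prime_mul_cancel]

theorem indProd_const (φ : Irr (P p k)) :
    indProd (fun _ : Fin p => φ) = ∑ ε : Fin p, calX φ ε := by
  funext x
  induction x using induction_wrMk with | _ f s
  rw [Finset.sum_apply]
  by_cases hs : s = 1
  · subst hs
    have hcalX : ∀ ε, calX φ ε (wrMk f 1) = piProd (fun _ : Fin p => φ.1) f :=
      fun ε => congrFun (calX_comp_baseInclusion φ ε) f
    refine (congrFun (indProd_comp_baseInclusion fun _ : Fin p => φ) f).trans ?_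
    simp [hcalX, card_cyc]
  · simp only [indProd_wrMk_of_ne _ _ hs, calX_wrMk, ← Finset.mul_sum, sum_phi hs, mul_zero]

theorem irr_succ_cases (θ : Irr (P p (k + 1))) :
    (∃ (φ : Irr (P p k)) (ε : Fin p), θ.1 = calX φ ε) ∨
      ∃ θs : Fin p → Irr (P p k), (¬ ∀ i j, θs i = θs j) ∧ θ.1 = indProd θs := by
  have hres := θ.2.isChar.comp_hom (baseInclusion p k)
  obtain ⟨ψ, hψ⟩ := hres.exists_irr_charForm_ne_zero fun h0 =>
    θ.2.apply_one_ne_zero (by simpa using congrFun h0 1)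
  obtain ⟨θs, hθs⟩ := ψ.2.exists_eq_piProd
  obtain ⟨n, hn⟩ := hres.exists_charForm_eq_natCast ψ.2.isChar
  rw [hn] at hψ
  rw [hθs, ← charForm_indProd θ.2.isChar] at hn
  by_cases hall : ∀ i j, θs i = θs j
  · left
    have hconst : θs = fun _ => θs 0 := funext fun i => hall i 0
    rw [hconst, indProd_const, map_sum] at hn
    obtain ⟨ε, -, hε⟩ := Finset.exists_ne_zero_of_sum_ne_zero (hn.trans_ne hψ)
    exact ⟨θs 0, ε, θ.2.eq_of_charForm_ne_zero (isIrrChar_calX _ _) hε⟩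
  · right
    exact ⟨θs, hall, θ.2.eq_of_charForm_eq_natCast (indProd_inv θs) (charForm_indProd_self hall)
      (Nat.cast_ne_zero.mp hψ) hn⟩

theorem calX_ne_indProd (φ : Irr (P p k)) (ε : Fin p) (θs : Fin p → Irr (P p k)) :
    calX φ ε ≠ indProd θs := fun h =>
  let ⟨f, _, hs, hne⟩ := exists_calX_wrMk_ne_zero φ ε
  hne (by rw [h, indProd_wrMk_of_ne θs f hs])

theorem exists_cyc_of_indProd_eq {θs θs' : Fin p → Irr (P p k)} (h : indProd θs = indProd θs') :
    ∃ t : cyc p, ∀ i, θs i = θs' ((t : Perm (Fin p)) i) := by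
  classical
  have hirr : ∀ (η : Fin p → Irr (P p k)) (t : cyc p),
      IsIrrChar (piProd fun i => (η ((t : Perm (Fin p)) i)).1) :=
    fun η t => isIrrChar_piProd fun i => (η _).2
  have hsum := indProd_comp_baseInclusion θs
  rw [h, indProd_comp_baseInclusion] at hsum
  have hform := congrArg (charForm (piProd fun i => (θs i).1)) hsum
  rw [map_sum, map_sum] at hform
  have hne : ∑ t : cyc p, charForm (piProd fun i => (θs i).1)
      (piProd fun i => (θs ((t : Perm (Fin p)) i)).1) ≠ 0 := by
    refine (Finset.sum_congr rfl fun t _ => (hirr θs 1).charForm_eq (hirr θs t)).trans_ne ?_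
    rw [Finset.sum_boole, Nat.cast_ne_zero, Finset.card_ne_zero]
    exact ⟨1, Finset.mem_filter.mpr ⟨Finset.mem_univ _, rfl⟩⟩
  obtain ⟨t, -, ht⟩ := Finset.exists_ne_zero_of_sum_ne_zero (hform.trans_ne hne)
  exact ⟨t, congrFun (piProd_injective (a₁ := θs) (a₂ := fun i => θs' ((t : Perm (Fin p)) i))
    ((hirr θs 1).eq_of_charForm_ne_zero (hirr θs' t) ht))⟩

theorem indProd_comp_cyc (θs : Fin p → Irr (P p k)) (t : cyc p) :
    indProd (fun i => θs ((t : Perm (Fin p)) i)) = indProd θs := by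
  funext x
  induction x using induction_wrMk with | _ f s
  by_cases hs : s = 1
  · subst hs
    have hbase : indProd (fun i => θs ((t : Perm (Fin p)) i)) ∘ baseInclusion p k =
        indProd θs ∘ baseInclusion p k := by
      rw [indProd_comp_baseInclusion, indProd_comp_baseInclusion, ← Equiv.sum_comp (Equiv.mulLeft t)
        fun s : cyc p => piProd fun i => (θs ((s : Perm (Fin p)) i)).1]
      rfl
    exact congrFun hbase f
  · rw [indProd_wrMk_of_ne _ _ hs, indProd_wrMk_of_ne _ _ hs]

section Conjugation

variable {h : Perm (Fin (p ^ k))} {m : Perm (Fin p)}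
  (hh : h ∈ Subgroup.normalizer (P p k : Set (Perm (Fin (p ^ k)))))
  (hm : m ∈ Subgroup.normalizer (cyc p : Set (Perm (Fin p))))

theorem calX_conj (φ : Irr (P p k)) {ε ε' : Fin p} (hε : ∀ s, phi ε (conjEquiv hm s) = phi ε' s)
    (x : P p (k + 1)) :
    calX φ ε (conjEquiv (wr_mem_normalizer hh hm) x) = calX (φ.conj hh) ε' x := by
  induction x using induction_wrMk with | _ f s
  rw [conjEquiv_wrMk hh hm, calX_wrMk, calX_wrMk, hε]
  congr 1
  obtain ⟨hirr, hchar⟩ := φ.2.choose_spec.choose_spec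
  obtain ⟨hirr', hchar'⟩ := (φ.conj hh).2.choose_spec.choose_spec
  set ρ := φ.2.choose_spec.choose
  set σ := (φ.conj hh).2.choose_spec.choose
  have hirrc : Representation.IsIrreducible (ρ.comp (conjEquiv hh).toMonoidHom) :=
    isIrreducible_comp_mulEquiv (conjEquiv hh) hirr
  have : NeZero (Nat.card (P p k) : ℂ) := ⟨natCast_card_ne_zero _⟩
  obtain ⟨e⟩ : Nonempty (Representation.Equiv (ρ.comp (conjEquiv hh).toMonoidHom) σ) := by
    refine nonempty_equiv_of_character_eq ?_
    rw [← hchar']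
    funext x
    exact (congrFun hchar (conjEquiv hh x)).symm
  rw [trace_wreathTensor_equiv e]
  exact trace_wreathTensor_conj ρ (fun i => conjEquiv hh (f i)) s m

theorem indProd_conj (θs : Fin p → Irr (P p k)) (x : P p (k + 1)) :
    indProd θs (conjEquiv (wr_mem_normalizer hh hm) x) =
      indProd (fun i => (θs (m⁻¹ i)).conj hh) x := by
  induction x using induction_wrMk with | _ f s
  rw [conjEquiv_wrMk hh hm]
  by_cases hs : s = 1
  · subst hs
    rw [map_one, indProd_wrMk_one, indProd_wrMk_one, ← Equiv.sum_comp (conjEquiv hm).toEquiv]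
    refine Finset.sum_congr rfl fun t _ => ?_
    conv_rhs => rw [← Equiv.prod_comp m]
    simp [Irr.conj, conjEquiv]
  · rw [indProd_wrMk_of_ne _ _ hs,
      indProd_wrMk_of_ne _ _ ((EmbeddingLike.map_eq_one_iff (f := conjEquiv hm)).not.mpr hs)]

end Conjugation

end WreathCharacters

/-! ### Tree functions of irreducible characters -/

section TreeFunctions

variable {p k : ℕ}

theorem Labeling.root_node (f : Fin p → Labeling p k) (ε : Fin (p + 1)) :
    (Labeling.node f ε).root = ε := rfl

theorem Labeling.sub_node (f : Fin p → Labeling p k) (ε : Fin (p + 1)) :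
    (Labeling.node f ε).sub = f := rfl

theorem Labeling.toTree_succ_eq_iff {t₁ t₂ : Labeling p (k + 1)} :
    t₁.toTree = t₂.toTree ↔ t₁.root = t₂.root ∧
      ∃ s : cyc p, ∀ i, (t₁.sub i).toTree = (t₂.sub ((s : Perm (Fin p)) i)).toTree := by
  refine Quotient.eq.trans ⟨?_, ?_⟩
  · rintro ⟨γ, hγ, h⟩
    exact ⟨h ⟨[], Nat.succ_pos k⟩, ⟨γ [], hγ []⟩, fun i => Quotient.eq.mpr
      ⟨fun q => γ (i :: q), fun q => hγ _, fun q => h ⟨i :: q.1, Nat.succ_lt_succ q.2⟩⟩⟩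
  · rintro ⟨hroot, s, h⟩
    choose δ hδ h using fun i => Quotient.eq.mp (h i)
    refine ⟨fun q => q.casesOn s δ, fun q => ?_, ?_⟩
    · cases q with
      | nil => exact s.2
      | cons i q => exact hδ i q
    · rintro ⟨_ | ⟨i, q⟩, hq⟩
      · exact hroot
      · exact h i ⟨q, Nat.lt_of_succ_lt_succ hq⟩

theorem TreeFun.toTree_out (T : TreeFun p k) : (Quotient.out T).toTree = T := Quotient.out_eq T

theorem Labeling.toTree_eq_node_iff {t : Labeling p (k + 1)} {F : Fin p → TreeFun p k}
    {ε : Fin (p + 1)} : t.toTree = TreeFun.node F ε ↔ t.root = ε ∧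
      ∃ s : cyc p, ∀ i, (t.sub i).toTree = F ((s : Perm (Fin p)) i) := by
  rw [TreeFun.node, toTree_succ_eq_iff, root_node, sub_node]
  simp only [TreeFun.toTree_out]

theorem TreeFun.node_eq_node_iff {F F' : Fin p → TreeFun p k} {ε ε' : Fin (p + 1)} :
    TreeFun.node F ε = TreeFun.node F' ε' ↔ ε = ε' ∧
      ∃ s : cyc p, ∀ i, F i = F' ((s : Perm (Fin p)) i) := by
  rw [TreeFun.node, Labeling.toTree_eq_node_iff, Labeling.root_node, Labeling.sub_node]
  simp only [TreeFun.toTree_out]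

instance subsingleton_treeFun_zero : Subsingleton (TreeFun p 0) :=
  ⟨fun S T => Quotient.inductionOn₂ S T fun _ _ =>
    congrArg _ (funext fun s => absurd s.2 (Nat.not_lt_zero _))⟩

variable [Fact p.Prime]

theorem tree_of_eq_calX {θ : Irr (P p (k + 1))} {φ : Irr (P p k)} {ε : Fin p}
    (h : θ.1 = calX φ ε) : tree θ = TreeFun.node (fun _ => tree φ) ε.castSucc := by
  have hex : ∃ (φ : Irr (P p k)) (ε : Fin p), θ.1 = calX φ ε := ⟨φ, ε, h⟩
  rw [tree, dif_pos hex]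
  obtain ⟨hφ, hε⟩ := calX_injective (hex.choose_spec.choose_spec.symm.trans h)
  rw [hε, hφ]

theorem tree_of_eq_indProd {θ : Irr (P p (k + 1))} {θs : Fin p → Irr (P p k)}
    (hne : ¬ ∀ i j, θs i = θs j) (h : θ.1 = indProd θs) :
    tree θ = TreeFun.node (fun i => tree (θs i)) (Fin.last p) := by
  have hnot : ¬ ∃ (φ : Irr (P p k)) (ε : Fin p), θ.1 = calX φ ε := by
    rintro ⟨φ, ε, h'⟩
    exact calX_ne_indProd φ ε θs (h'.symm.trans h)
  have hex : ∃ θs : Fin p → Irr (P p k), (¬ ∀ i j, θs i = θs j) ∧ θ.1 = indProd θs :=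
    ⟨θs, hne, h⟩
  rw [tree, dif_neg hnot, dif_pos hex, TreeFun.node_eq_node_iff]
  obtain ⟨t, ht⟩ := exists_cyc_of_indProd_eq (hex.choose_spec.2.symm.trans h)
  exact ⟨rfl, t, fun i => by rw [ht]⟩

instance subsingleton_P_zero : Subsingleton (P p 0) := by
  have : Subsingleton (Fin (p ^ 0)) := by rw [pow_zero]; infer_instance
  infer_instance

instance subsingleton_irr_P_zero : Subsingleton (Irr (P p 0)) := by
  refine ⟨fun χ ψ => Subtype.ext (χ.2.eq_of_charForm_ne_zero ψ.2 ?_)⟩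
  rw [charForm_apply, Fintype.sum_subsingleton _ 1, inv_one]
  exact mul_ne_zero (inv_ne_zero (natCast_card_ne_zero _))
    (mul_ne_zero χ.2.apply_one_ne_zero ψ.2.apply_one_ne_zero)

theorem tree_injective (k : ℕ) : Function.Injective (tree : Irr (P p k) → TreeFun p k) := by
  induction k with
  | zero => exact fun χ ψ _ => Subsingleton.elim χ ψ
  | succ k ih =>
    intro χ ψ h
    rcases irr_succ_cases χ with ⟨φ, ε, hχ⟩ | ⟨θs, hθs, hχ⟩ <;>
      rcases irr_succ_cases ψ with ⟨φ', ε', hψ⟩ | ⟨θs', hθs', hψ⟩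
    · rw [tree_of_eq_calX hχ, tree_of_eq_calX hψ, TreeFun.node_eq_node_iff] at h
      obtain ⟨hε, _, hφ⟩ := h
      apply Subtype.ext
      rw [hχ, hψ, ih (hφ 0), Fin.castSucc_injective p hε]
    · rw [tree_of_eq_calX hχ, tree_of_eq_indProd hθs' hψ, TreeFun.node_eq_node_iff] at h
      exact absurd h.1 (Fin.castSucc_lt_last ε).ne
    · rw [tree_of_eq_indProd hθs hχ, tree_of_eq_calX hψ, TreeFun.node_eq_node_iff] at h
      exact absurd h.1.symm (Fin.castSucc_lt_last ε').ne
    · rw [tree_of_eq_indProd hθs hχ, tree_of_eq_indProd hθs' hψ, TreeFun.node_eq_node_iff] at h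
      obtain ⟨-, s, hs⟩ := h
      have hperm : θs = fun i => θs' ((s : Perm (Fin p)) i) := funext fun i => ih (hs i)
      apply Subtype.ext
      rw [hχ, hψ, hperm, indProd_comp_cyc]

theorem tree_mem_admissibleTrees (θ : Irr (P p k)) : tree θ ∈ admissibleTrees p k := by
  induction k with
  | zero => exact fun t _ => trivial
  | succ k ih =>
    intro t ht
    rcases irr_succ_cases θ with ⟨φ, ε, h⟩ | ⟨θs, hθs, h⟩
    · rw [tree_of_eq_calX h, Labeling.toTree_eq_node_iff] at ht
      obtain ⟨hroot, _, hs⟩ := ht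
      refine ⟨fun i => ih φ _ (hs i), fun _ i j => (hs i).trans (hs j).symm, fun hlast => ?_⟩
      exact absurd (hroot.symm.trans hlast) (Fin.castSucc_lt_last ε).ne
    · rw [tree_of_eq_indProd hθs h, Labeling.toTree_eq_node_iff] at ht
      obtain ⟨hroot, s, hs⟩ := ht
      refine ⟨fun i => ih _ _ (hs i), fun hne => absurd hroot hne, fun _ hall =>
        hθs fun i j => ?_⟩
      have hij := hall ((s : Perm (Fin p))⁻¹ i) ((s : Perm (Fin p))⁻¹ j)
      rw [hs, hs] at hij
      simpa using tree_injective k hij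

theorem Irr.conj_congr {G : Type*} [Group G] {H : Subgroup G} (χ : Irr H) {g g' : G}
    (hg : g ∈ Subgroup.normalizer (H : Set G)) (hg' : g' ∈ Subgroup.normalizer (H : Set G))
    (h : g = g') : χ.conj hg = χ.conj hg' := by
  subst h
  rfl

theorem Irr.conj_one {G : Type*} [Group G] {H : Subgroup G} (χ : Irr H)
    (h : (1 : G) ∈ Subgroup.normalizer (H : Set G)) : χ.conj h = χ :=
  Subtype.ext (funext fun x => congrArg χ.1 (Subtype.ext (by simp [conjEquiv])))

theorem Irr.conj_injective {G : Type*} [Group G] {H : Subgroup G} {h : G}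
    (hh : h ∈ Subgroup.normalizer (H : Set G)) :
    Function.Injective fun χ : Irr H => χ.conj hh := by
  intro χ ψ hχψ
  refine Subtype.ext (funext fun x => ?_)
  have hx := congrFun (congrArg Subtype.val hχψ) ((conjEquiv hh).symm x)
  simpa [Irr.conj] using hx

section Conjugation

variable {h : Perm (Fin (p ^ k))} {m : Perm (Fin p)}
  (hh : h ∈ Subgroup.normalizer (P p k : Set (Perm (Fin (p ^ k)))))
  (hm : m ∈ Subgroup.normalizer (cyc p : Set (Perm (Fin p)))) {θ : Irr (P p (k + 1))}

theorem tree_conj_of_eq_indProd {θs : Fin p → Irr (P p k)} (hne : ¬ ∀ i j, θs i = θs j)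
    (hθ : θ.1 = indProd θs) :
    tree (θ.conj (wr_mem_normalizer hh hm)) =
      TreeFun.node (fun i => tree ((θs (m⁻¹ i)).conj hh)) (Fin.last p) := by
  refine tree_of_eq_indProd (fun hall => hne fun i j => ?_) (funext fun x => ?_)
  · simpa using Irr.conj_injective hh (hall (m i) (m j))
  · rw [← indProd_conj hh hm, ← hθ]
    rfl

theorem tree_conj_of_eq_calX {φ : Irr (P p k)} {ε ε' : Fin p}
    (hε : ∀ s, phi ε (conjEquiv hm s) = phi ε' s) (hθ : θ.1 = calX φ ε) :
    tree (θ.conj (wr_mem_normalizer hh hm)) =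
      TreeFun.node (fun _ => tree (φ.conj hh)) ε'.castSucc := by
  refine tree_of_eq_calX (funext fun x => ?_)
  rw [← calX_conj hh hm φ hε, ← hθ]
  rfl

theorem tree_conj_wr {act : Labeling p k → Labeling p k} {lab : Fin (p + 1) → Fin (p + 1)}
    {lab' : Fin p → Fin p}
    (hact : ∀ (χ : Irr (P p k)) (t : Labeling p k), t.toTree = tree χ →
      tree (χ.conj hh) = (act t).toTree)
    (hlast : lab (Fin.last p) = Fin.last p) (hlab : ∀ ε, lab ε.castSucc = (lab' ε).castSucc)
    (hphi : ∀ ε s, phi ε (conjEquiv hm s) = phi (lab' ε) s)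
    {t : Labeling p (k + 1)} (ht : t.toTree = tree θ) :
    tree (θ.conj (wr_mem_normalizer hh hm)) =
      (Labeling.node (fun i => act (t.sub (m⁻¹ i))) (lab t.root)).toTree := by
  symm
  rcases irr_succ_cases θ with ⟨φ, ε, hθ⟩ | ⟨θs, hθs, hθ⟩
  · rw [tree_of_eq_calX hθ, Labeling.toTree_eq_node_iff] at ht
    obtain ⟨hroot, _, hs⟩ := ht
    rw [tree_conj_of_eq_calX hh hm (hphi ε) hθ, Labeling.toTree_eq_node_iff, Labeling.root_node,
      Labeling.sub_node, hroot]
    exact ⟨hlab ε, 1, fun i => (hact φ _ (hs _)).symm⟩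
  · rw [tree_of_eq_indProd hθs hθ, Labeling.toTree_eq_node_iff] at ht
    obtain ⟨hroot, s, hs⟩ := ht
    rw [tree_conj_of_eq_indProd hh hm hθs hθ, Labeling.toTree_eq_node_iff, Labeling.root_node,
      Labeling.sub_node, hroot]
    refine ⟨hlast, conjEquiv (inv_mem hm) s, fun i => (hact _ _ (hs _)).symm.trans ?_⟩
    simp [conjEquiv]

end Conjugation

theorem sigma_succ_self (u : (ZMod p)ˣ) : sigma u (k + 1) (k + 1) = wr (fun _ => 1) (mulPerm u) :=
  if_pos rfl

theorem sigma_succ_of_ne (u : (ZMod p)ˣ) {j : ℕ} (hj : j ≠ k + 1) :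
    sigma u (k + 1) j = wr (fun _ => sigma u k j) 1 := if_neg hj

theorem tree_conj_sigma (u : (ZMod p)ˣ) (j : ℕ) (θ : Irr (P p k)) {t : Labeling p k}
    (ht : t.toTree = tree θ) :
    tree (θ.conj (sigma_mem_normalizer u k j)) = (t.sigmaAct u j).toTree := by
  induction k with
  | zero => exact Subsingleton.elim _ _
  | succ k ih =>
    by_cases hj : j = k + 1
    · subst hj
      rw [θ.conj_congr _ (wr_mem_normalizer (one_mem _) (mulPerm_mem_normalizer u))
        (sigma_succ_self u), Labeling.sigmaAct, if_pos rfl]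
      exact tree_conj_wr (one_mem _) _ (act := id) (fun χ t ht => by rw [χ.conj_one, ← ht, id])
        (lab := tauLabel u) (if_pos rfl) (tauLabel_castSucc u) (phi_conj_mulPerm u) ht
    · rw [θ.conj_congr _ (wr_mem_normalizer (sigma_mem_normalizer u k j) (one_mem _))
        (sigma_succ_of_ne u hj), Labeling.sigmaAct, if_neg hj]
      exact tree_conj_wr _ (one_mem _) (act := Labeling.sigmaAct u j) (lab := id) (lab' := id)
        (fun χ t ht => ih χ ht) rfl (fun _ => rfl)
        (fun ε s => congrArg (phi ε) (Subtype.ext (by simp [conjEquiv]))) ht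

end TreeFunctions

/-! ### Characters of the Sylow subgroup of `S_n` -/

theorem closure_swap_finRotate {a : ℕ} (h : 2 ≤ a) :
    Subgroup.closure {Equiv.swap (⟨0, Nat.lt_of_lt_of_le Nat.zero_lt_two h⟩ : Fin a) ⟨1, h⟩,
      finRotate a} = ⊤ := by
  obtain ⟨n, rfl⟩ : ∃ n, a = n + 2 := ⟨a - 2, by omega⟩
  have hadj := Perm.closure_cycle_adjacent_swap (isCycle_finRotate (n := n)) support_finRotate 0
  rw [finRotate_apply, zero_add] at hadj
  rwa [Set.pair_comm]

namespace PadicExpansion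

variable {p n : ℕ} (E : PadicExpansion p n)

theorem blockHom_apply (h : ∀ i, Fin (E.a i) → Perm (Fin (p ^ E.k i))) (i : Fin E.t)
    (j : Fin (E.a i)) (r : Fin (p ^ E.k i)) :
    E.blockHom h (E.point ⟨i, j, r⟩) = E.point ⟨i, j, h i j r⟩ := by
  simp [blockHom, Equiv.permCongr_apply, Equiv.prodShear]

theorem blockHom_injective : Function.Injective E.blockHom := by
  intro f g h
  funext i j
  refine Equiv.ext fun r => ?_
  have hpoint := Equiv.congr_fun h (E.point ⟨i, j, r⟩)
  simpa [blockHom_apply] using hpoint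

theorem permBlocks_apply_self (i : Fin E.t) (π : Perm (Fin (E.a i))) (j : Fin (E.a i))
    (r : Fin (p ^ E.k i)) :
    E.permBlocks i π (E.point ⟨i, j, r⟩) = E.point ⟨i, π j, r⟩ := by
  simp [permBlocks, Equiv.permCongr_apply]

theorem permBlocks_apply_of_ne {i i' : Fin E.t} (h : i' ≠ i) (π : Perm (Fin (E.a i)))
    (j : Fin (E.a i')) (r : Fin (p ^ E.k i')) :
    E.permBlocks i π (E.point ⟨i', j, r⟩) = E.point ⟨i', j, r⟩ := by
  simp [permBlocks, Equiv.permCongr_apply, Pi.mulSingle_eq_of_ne h]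

/-- `permBlocks` as a homomorphism of groups. -/
def permBlocksHom (i : Fin E.t) : Perm (Fin (E.a i)) →* Perm (Fin n) :=
  MonoidHom.mk' (E.permBlocks i) fun π π' => by
    refine Equiv.ext fun x => ?_
    obtain ⟨⟨i', j, r⟩, rfl⟩ := E.point.surjective x
    by_cases h : i' = i
    · subst h
      simp only [Perm.mul_apply, permBlocks_apply_self]
    · simp only [Perm.mul_apply, E.permBlocks_apply_of_ne h]

theorem blockHom_mul_permBlocks (h : ∀ i, Fin (E.a i) → Perm (Fin (p ^ E.k i))) (i : Fin E.t)
    (π : Perm (Fin (E.a i))) :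
    E.blockHom h * E.permBlocks i π =
      E.permBlocks i π * E.blockHom (Function.update h i fun j => h i (π j)) := by
  refine Equiv.ext fun x => ?_
  obtain ⟨⟨i', j, r⟩, rfl⟩ := E.point.surjective x
  by_cases hi : i' = i
  · subst hi
    simp only [Perm.mul_apply, permBlocks_apply_self, blockHom_apply, Function.update_self]
  · simp only [Perm.mul_apply, E.permBlocks_apply_of_ne hi, blockHom_apply,
      Function.update_of_ne hi]

theorem conj_permBlocks_shiftHom (i : Fin E.t) (π : Perm (Fin (E.a i))) (j : Fin (E.a i))
    (h : Perm (Fin (p ^ E.k i))) :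
    MulAut.conj (E.permBlocks i π) (E.shiftHom i j h) = E.shiftHom i (π j) h := by
  rw [MulAut.conj_apply, mul_inv_eq_iff_eq_mul]
  change _ * E.blockHom _ = E.blockHom _ * _
  rw [blockHom_mul_permBlocks]
  congr 2
  funext i'
  by_cases hi : i' = i
  · subst hi
    funext j
    simp [Pi.mulSingle_apply]
  · simp [Function.update_of_ne hi, Pi.mulSingle_eq_of_ne hi]

theorem rhoGroup_eq_range (i : Fin E.t) : E.rhoGroup i = (E.permBlocksHom i).range := by
  rw [MonoidHom.range_eq_map, rhoGroup]
  by_cases h : 2 ≤ E.a i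
  · rw [← closure_swap_finRotate h, MonoidHom.map_closure, Set.image_pair, xi, dif_pos h]
    rfl
  · have ha : E.a i = 1 := le_antisymm (by omega) (E.a_pos i)
    have : Subsingleton (Fin (E.a i)) := by rw [ha]; infer_instance
    have hzeta : E.zeta i = 1 := by
      rw [zeta, Subsingleton.elim (finRotate (E.a i)) 1]
      exact map_one (E.permBlocksHom i)
    rw [xi, dif_neg h, hzeta, Set.pair_eq_singleton, Subgroup.closure_singleton_one,
      Subsingleton.elim (⊤ : Subgroup (Perm (Fin (E.a i)))) ⊥, Subgroup.map_bot]

theorem mem_rhoGroup_iff {i : Fin E.t} {ρ : Perm (Fin n)} :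
    ρ ∈ E.rhoGroup i ↔ ∃ π, E.permBlocks i π = ρ := by
  rw [rhoGroup_eq_range]
  rfl

variable [Fact p.Prime]

theorem permBlocksHom_injective (i : Fin E.t) : Function.Injective (E.permBlocksHom i) := by
  intro π π' h
  refine Equiv.ext fun j => ?_
  have hpoint : E.permBlocks i π (E.point ⟨i, j, ⟨0, Nat.pow_pos (NeZero.pos p)⟩⟩) =
    E.permBlocks i π' _ := Equiv.congr_fun h _
  rw [permBlocks_apply_self, permBlocks_apply_self] at hpoint
  simpa using E.point.injective hpoint

theorem nonempty_rhoGroup_mulEquiv (i : Fin E.t) :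
    Nonempty (E.rhoGroup i ≃* Perm (Fin (E.a i))) := by
  rw [rhoGroup_eq_range]
  exact ⟨(MonoidHom.ofInjective (E.permBlocksHom_injective i)).symm⟩

theorem prodHom_injective : Function.Injective E.prodHom := fun x y h => by
  funext i j
  exact Subtype.ext (congrFun (congrFun (E.blockHom_injective h) i) j)

/-- The group `P_n` is the direct product of the groups `P_{p^{k_i}}`. -/
noncomputable def prodEquiv : (∀ i, Fin (E.a i) → P p (E.k i)) ≃* E.sylow :=
  MonoidHom.ofInjective E.prodHom_injective

variable {E} {θ : Irr E.sylow} {θs : ∀ i, Fin (E.a i) → Irr (P p (E.k i))}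

theorem isProd_iff :
    E.IsProd θ θs ↔ θ.1 ∘ E.prodEquiv = piProd fun i => piProd fun j => (θs i j).1 :=
  ⟨fun h => funext h, fun h => congrFun h⟩

theorem IsProd.unique {θs' : ∀ i, Fin (E.a i) → Irr (P p (E.k i))}
    (h : E.IsProd θ θs) (h' : E.IsProd θ θs') : θs = θs' := by
  have hirr : ∀ (η : ∀ i, Fin (E.a i) → Irr (P p (E.k i))) i,
      IsIrrChar (piProd fun j => (η i j).1) := fun η i => isIrrChar_piProd fun j => (η i j).2
  have houter := piProd_injective (a₁ := fun i => ⟨_, hirr θs i⟩) (a₂ := fun i => ⟨_, hirr θs' i⟩)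
    ((isProd_iff.mp h).symm.trans (isProd_iff.mp h'))
  exact funext fun i => piProd_injective (congrArg Subtype.val (congrFun houter i))

theorem existsUnique_isProd (θ : Irr E.sylow) : ∃! θs, E.IsProd θ θs := by
  obtain ⟨Ψ, hΨ⟩ := (θ.2.comp_equiv E.prodEquiv).exists_eq_piProd
  choose θs hθs using fun i => (Ψ i).2.exists_eq_piProd
  have h : E.IsProd θ θs := isProd_iff.mpr (hΨ.trans (congrArg _ (funext hθs)))
  exact ⟨θs, h, fun θs' h' => h'.unique h⟩

theorem IsProd.tree_eq (h : E.IsProd θ θs) (i : Fin E.t) (j : Fin (E.a i)) :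
    E.tree θ i j = SylowTree.tree (θs i j) := by
  have hex : ∃ θs, E.IsProd θ θs := ⟨θs, h⟩
  rw [tree, dif_pos hex, hex.choose_spec.unique h]

theorem mem_N_of_conj {g : Perm (Fin n)}
    {c : (∀ i, Fin (E.a i) → P p (E.k i)) → ∀ i, Fin (E.a i) → P p (E.k i)}
    (hc : ∀ x, g⁻¹ * E.prodHom x * g = E.prodHom (c x)) : g ∈ E.N := by
  refine mem_normalizer_of_inv_mul_mul_mem ?_
  rintro _ ⟨x, rfl⟩
  exact ⟨c x, (hc x).symm⟩

theorem IsProd.conj (h : E.IsProd θ θs) {θs' : ∀ i, Fin (E.a i) → Irr (P p (E.k i))}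
    {g : Perm (Fin n)} (hg : g ∈ E.N)
    {c : (∀ i, Fin (E.a i) → P p (E.k i)) → ∀ i, Fin (E.a i) → P p (E.k i)}
    (hc : ∀ x, g⁻¹ * E.prodHom x * g = E.prodHom (c x))
    (hprod : ∀ x, ∏ i, ∏ j, (θs i j).1 (c x i j) = ∏ i, ∏ j, (θs' i j).1 (x i j)) :
    E.IsProd (θ.conj hg) θs' := fun x => by
  rw [← hprod, ← h]
  exact congrArg θ.1 (Subtype.ext (hc x))

section InsideBlock

variable {i : Fin E.t} {j : Fin (E.a i)} {g : Perm (Fin (p ^ E.k i))}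
  (hg : g ∈ Subgroup.normalizer (P p (E.k i) : Set (Perm (Fin (p ^ E.k i)))))

theorem shiftHom_conj (x : ∀ i, Fin (E.a i) → P p (E.k i)) :
    (E.shiftHom i j g)⁻¹ * E.prodHom x * E.shiftHom i j g =
      E.prodHom (Function.update x i (Function.update (x i) j (conjEquiv hg (x i j)))) := by
  change (E.blockHom (Pi.mulSingle i (Pi.mulSingle j g)))⁻¹ * E.blockHom _ * E.blockHom _ =
    E.blockHom _
  rw [← map_inv, ← map_mul, ← map_mul]
  congr 1
  funext i' j'
  by_cases hi : i' = i
  · subst hi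
    by_cases hj : j' = j
    · subst hj
      simp [conjEquiv]
    · simp [hj]
  · simp [hi]

include hg in
theorem shiftHom_mem_N : E.shiftHom i j g ∈ E.N := mem_N_of_conj (shiftHom_conj hg)

theorem IsProd.conj_shiftHom (hθ : E.IsProd θ θs) :
    E.IsProd (θ.conj (shiftHom_mem_N (j := j) hg))
      (Function.update θs i (Function.update (θs i) j ((θs i j).conj hg))) := by
  refine hθ.conj _ (shiftHom_conj hg) fun x => ?_
  refine Finset.prod_congr rfl fun i' _ => Finset.prod_congr rfl fun j' _ => ?_
  by_cases hi : i' = i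
  · subst hi
    by_cases hj : j' = j
    · subst hj
      simp only [Function.update_self]
      rfl
    · simp [hj]
  · simp [hi]

end InsideBlock

theorem permBlocks_conj (i : Fin E.t) (π : Perm (Fin (E.a i)))
    (x : ∀ i, Fin (E.a i) → P p (E.k i)) :
    (E.permBlocks i π)⁻¹ * E.prodHom x * E.permBlocks i π =
      E.prodHom (Function.update x i fun j => x i (π j)) := by
  change _ * E.blockHom _ * _ = E.blockHom _
  rw [mul_assoc, blockHom_mul_permBlocks, inv_mul_cancel_left]
  congr 1
  funext i'
  by_cases h : i' = i
  · subst h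
    simp only [Function.update_self]
  · simp only [Function.update_of_ne h]

theorem permBlocks_mem_N (i : Fin E.t) (π : Perm (Fin (E.a i))) : E.permBlocks i π ∈ E.N :=
  mem_N_of_conj (permBlocks_conj i π)

theorem IsProd.conj_permBlocks (hθ : E.IsProd θ θs) (i : Fin E.t) (π : Perm (Fin (E.a i))) :
    E.IsProd (θ.conj (permBlocks_mem_N i π))
      (Function.update θs i fun j => θs i (π⁻¹ j)) := by
  refine hθ.conj _ (permBlocks_conj i π) fun x => Finset.prod_congr rfl fun i' _ => ?_
  by_cases h : i' = i
  · subst h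
    simp only [Function.update_self]
    rw [← Equiv.prod_comp π fun j => (θs i' (π⁻¹ j)).1 (x i' j)]
    simp
  · simp only [Function.update_of_ne h]

theorem induces_permBlocks (i : Fin E.t) (π : Perm (Fin (E.a i))) :
    E.Induces i (E.permBlocks i π) π := fun x => by
  rw [factor, factor, Subgroup.map_map]
  exact congrArg (Subgroup.map · _) (MonoidHom.ext (E.conj_permBlocks_shiftHom i π x))

theorem factor_injective {i : Fin E.t} (hk : E.k i ≠ 0) : Function.Injective (E.factor i) := by
  intro x y hxy
  have := nontrivial_P (p := p) hk
  obtain ⟨g, hg⟩ := exists_ne (1 : P p (E.k i))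
  by_contra hne
  obtain ⟨g', -, h⟩ : E.shiftHom i x g ∈ E.factor i y := hxy ▸ ⟨g, g.2, rfl⟩
  have hx := congrFun (congrFun (E.blockHom_injective h) i) x
  exact hg (by simpa [Pi.mulSingle_eq_of_ne hne] using hx.symm)

theorem Induces.unique {i : Fin E.t} (hk : E.k i ≠ 0) {ρ : Perm (Fin n)}
    {π π' : Perm (Fin (E.a i))} (h : E.Induces i ρ π) (h' : E.Induces i ρ π') : π = π' :=
  Equiv.ext fun x => factor_injective hk ((h x).symm.trans (h' x))

theorem IsProd.tree_conj_permBlocks (hθ : E.IsProd θ θs) {i : Fin E.t}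
    {π π' : Perm (Fin (E.a i))} (h : E.Induces i (E.permBlocks i π') π) (j : Fin (E.a i)) :
    E.tree (θ.conj (permBlocks_mem_N i π')) i j = SylowTree.tree (θs i (π⁻¹ j)) := by
  by_cases hk : E.k i = 0
  · have : Subsingleton (TreeFun p (E.k i)) := by rw [hk]; infer_instance
    exact Subsingleton.elim _ _
  · obtain rfl := h.unique hk (induces_permBlocks i π')
    rw [(hθ.conj_permBlocks i π).tree_eq, Function.update_self]

end PadicExpansion

end SylowTree

open SylowTree SylowTree.PadicExpansion in
theorem theorem2_general (p : ℕ) [Fact p.Prime] (u : (ZMod p)ˣ) (n : ℕ) (E : PadicExpansion p n)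
    (θ : Irr E.sylow) :
    (∃! θs : ∀ i, Fin (E.a i) → Irr (P p (E.k i)), E.IsProd θ θs) ∧
    ∀ θs : ∀ i, Fin (E.a i) → Irr (P p (E.k i)), E.IsProd θ θs →
      (∀ i j, E.tree θ i j = SylowTree.tree (θs i j) ∧
        E.tree θ i j ∈ admissibleTrees p (E.k i)) ∧
      (∀ (i : Fin E.t) (j : Fin (E.a i)) (ℓ : ℕ), 1 ≤ ℓ → ℓ ≤ E.k i →
        ∃ (hσ : E.sigma u i j ℓ ∈ E.N)
          (hσ' : SylowTree.sigma u (E.k i) ℓ ∈ Subgroup.normalizer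
            (P p (E.k i) : Set (Perm (Fin (p ^ E.k i))))),
          E.tree (θ.conj hσ) i j = SylowTree.tree ((θs i j).conj hσ') ∧
          (∀ t : Labeling p (E.k i), t.toTree = SylowTree.tree (θs i j) →
            SylowTree.tree ((θs i j).conj hσ') = (t.sigmaAct u ℓ).toTree) ∧
          (∀ j', j' ≠ j → E.tree (θ.conj hσ) i j' = SylowTree.tree (θs i j')) ∧
          (∀ i', i' ≠ i → ∀ j', E.tree (θ.conj hσ) i' j' = SylowTree.tree (θs i' j'))) ∧
      (∀ y : Fin E.t,
        Nonempty (E.rhoGroup y ≃* Perm (Fin (E.a y))) ∧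
        ∀ ρ ∈ E.rhoGroup y, ∃ hρ : ρ ∈ E.N,
          (∃ π, E.Induces y ρ π) ∧
          ∀ π, E.Induces y ρ π →
            (∀ j, E.tree (θ.conj hρ) y j = SylowTree.tree (θs y (π⁻¹ j))) ∧
            (∀ z, z ≠ y → ∀ j, E.tree (θ.conj hρ) z j = SylowTree.tree (θs z j))) := by
  refine ⟨existsUnique_isProd θ, fun θs hθs => ⟨fun i j => ?_, fun i j ℓ _ _ => ?_, fun y =>
    ⟨E.nonempty_rhoGroup_mulEquiv y, fun ρ hρ => ?_⟩⟩⟩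
  · rw [hθs.tree_eq]
    exact ⟨rfl, tree_mem_admissibleTrees _⟩
  · have hσ' := sigma_mem_normalizer u (E.k i) ℓ
    have hconj := hθs.conj_shiftHom (j := j) hσ'
    refine ⟨shiftHom_mem_N hσ', hσ', ?_, fun t ht => tree_conj_sigma u ℓ _ ht,
      fun j' hj' => ?_, fun i' hi' j' => ?_⟩
    · exact (hconj.tree_eq i j).trans (by rw [Function.update_self, Function.update_self])
    · exact (hconj.tree_eq i j').trans (by rw [Function.update_self, Function.update_of_ne hj'])
    · exact (hconj.tree_eq i' j').trans (by rw [Function.update_of_ne hi'])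
  · obtain ⟨π₀, rfl⟩ := E.mem_rhoGroup_iff.mp hρ
    refine ⟨permBlocks_mem_N y π₀, ⟨π₀, induces_permBlocks y π₀⟩, fun π hπ =>
      ⟨hθs.tree_conj_permBlocks hπ, fun z hz j => ?_⟩⟩
    rw [(hθs.conj_permBlocks y π₀).tree_eq, Function.update_of_ne hz]

theorem theorem2 (p : ℕ) [Fact p.Prime] (u : (ZMod p)ˣ) (hu : orderOf u = p - 1)
    (n : ℕ) (E : SylowTree.PadicExpansion p n) (θ : SylowTree.Irr E.sylow) :
    -- `θ` is in a unique way a product of irreducible characters of the factors of `P_n`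
    (∃! θs : ∀ i, Fin (E.a i) → SylowTree.Irr (SylowTree.P p (E.k i)), E.IsProd θ θs) ∧
    ∀ θs : ∀ i, Fin (E.a i) → SylowTree.Irr (SylowTree.P p (E.k i)), E.IsProd θ θs →
      -- `𝒯(θ)` is the tuple of the `𝒯(θ_{(i,j)})`, and it lies in `ℱ_n`
      (∀ i j, E.tree θ i j = SylowTree.tree (θs i j) ∧
        E.tree θ i j ∈ SylowTree.admissibleTrees p (E.k i)) ∧
      -- the action of `σ(i,j,ℓ)`
      (∀ (i : Fin E.t) (j : Fin (E.a i)) (ℓ : ℕ), 1 ≤ ℓ → ℓ ≤ E.k i →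
        ∃ (hσ : E.sigma u i j ℓ ∈ E.N)
          (hσ' : SylowTree.sigma u (E.k i) ℓ ∈ Subgroup.normalizer
            (SylowTree.P p (E.k i) : Set (Equiv.Perm (Fin (p ^ E.k i))))),
          E.tree (θ.conj hσ) i j = SylowTree.tree ((θs i j).conj hσ') ∧
          (∀ t : SylowTree.Labeling p (E.k i), t.toTree = SylowTree.tree (θs i j) →
            SylowTree.tree ((θs i j).conj hσ') = (t.sigmaAct u ℓ).toTree) ∧
          (∀ j', j' ≠ j → E.tree (θ.conj hσ) i j' = SylowTree.tree (θs i j')) ∧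
          (∀ i', i' ≠ i → ∀ j', E.tree (θ.conj hσ) i' j' = SylowTree.tree (θs i' j'))) ∧
      -- the action of `⟨ξ_y, ζ_y⟩`
      (∀ y : Fin E.t,
        Nonempty (E.rhoGroup y ≃* Equiv.Perm (Fin (E.a y))) ∧
        ∀ ρ ∈ E.rhoGroup y, ∃ hρ : ρ ∈ E.N,
          (∃ π, E.Induces y ρ π) ∧
          ∀ π, E.Induces y ρ π →
            (∀ j, E.tree (θ.conj hρ) y j = SylowTree.tree (θs y (π⁻¹ j))) ∧
            (∀ z, z ≠ y → ∀ j, E.tree (θ.conj hρ) z j = SylowTree.tree (θs z j))) :=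
  theorem2_general p u n E θ
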